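/- For $\rho\in\mathbb R$ let $\Omega_\rho=\{s\in\mathbb C:\operatorname{Re}s>\rho\}$. Let $n_0$ be a positive integer and let $\mu$ be a positive Radon measure on $[0,\infty)$ with $\int_0^\infty n_0^{-2\sigma}\,d\mu(\sigma)<\infty$ and such that $0$ lies in the support of $\mu$. For $n\ge n_0$ set $w_n=\int_0^\infty n^{-2\sigma}\,d\mu(\sigma)$. Let $\mathcal H_{\mathbf w}$ be the Hilbert space of all functions $f(s)=\sum_{n=n_0}^\infty a_n n^{-s}$ on $\Omega_{1/2}$ with $$\|f\|_{\mathcal H_{\mathbf w}}^2=\sum_{n=n_0}^\infty |a_n|^2w_n<\infty$$ (such series converge absolutely on $\Omega_{1/2}$). A multiplier of $\mathcal H_{\mathbf w}$ is a function $\phi$ on $\Omega_{1/2}$ such that $\phi f\in\mathcal H_{\mathbf w}$ for every $f\in\mathcal H_{\mathbf w}$; its norm is the operator norm of $M_\phi:f\mapsto\phi f$ on $\mathcal H_{\mathbf w}$. Let $H^\infty(\Omega_0)\cap\mathcal D$ be the algebra of all bounded holomorphic functions on $\Omega_0$ that are represented in some half-plane by a convergent Dirichlet series $\sum_{n=1}^\infty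 b_nn^{-s}$, with the norm $\sup_{s\in\Omega_0}|\phi(s)|$. **Theorem.** For every multiplier $\phi$ of $\mathcal H_{\mathbf w}$ the operator $M_\phi$ is bounded, and the multiplier algebra of $\mathcal H_{\mathbf w}$ is isometrically isomorphic to $H^\infty(\Omega_0)\cap\mathcal D$. The isomorphism sends a multiplier to its extension to $\Omega_0$: every multiplier is the restriction to $\Omega_{1/2}$ of a unique function in $H^\infty(\Omega_0)\cap\mathcal D$, every such restriction is a multiplier, and the two norms agree. In particular, the same conclusion holds for the space with $n_0=1$ and $w_n=1$ for all $n\ge1$ (the theorem of Hedenmalm, Lindqvist and Seip; $\mu$ is the unit point mass at $0$), and, for every real $\alpha\le 0$, for the space $\mathcal H_\alpha$ with $n_0=2$ and $w_n=(\log n)^\alpha$ for all $n\ge2$. -/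

import Mathlib

open Filter Topology MeasureTheory
open scoped NNReal LSeries.notation

namespace DirichletHilbert

/-- The open half-plane `Ω_ρ` of all complex `s` with `Re s > ρ`. -/
def halfPlane (ρ : ℝ) : Set ℂ := {s | ρ < s.re}

/-- `Ω_{1/2}` is contained in `Ω_0`. -/
def halfPlaneIncl (s : halfPlane (1 / 2)) : halfPlane 0 :=
  ⟨s.1, lt_trans (by norm_num : (0 : ℝ) < 1 / 2) s.2⟩

/-! ### The space `H_w` -/

/-- The complex vector space `H_w`: all functions `f` on `Ω_{1/2}` of the form
`f s = ∑_{n ≥ n₀} a n * n ^ (-s)` with `∑_{n ≥ n₀} ‖a n‖ ^ 2 * w n < ∞`. -/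
def HSpace (w : ℕ → ℝ) (n₀ : ℕ) : Submodule ℂ (halfPlane (1 / 2) → ℂ) where
  carrier := {f | ∃ a : ℕ → ℂ, (∀ n < n₀, a n = 0) ∧ (Summable fun n => ‖a n‖ ^ 2 * w n) ∧
    ∀ s : halfPlane (1 / 2), LSeriesHasSum a s (f s)}
  zero_mem' := ⟨0, fun _ _ => rfl, by simp,
    fun s => by
    have h : LSeries.term 0 (s : ℂ) = 0 := by funext n; simp [LSeries.term_def]
    rw [LSeriesHasSum, h]
    exact hasSum_zero⟩
  add_mem' := by
    rintro f g ⟨a, ha0, ha, haf⟩ ⟨b, hb0, hb, hbg⟩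
    refine ⟨a + b, fun n hn => by simp [ha0 n hn, hb0 n hn], ?_, fun s => (haf s).add (hbg s)⟩
    refine Summable.of_norm_bounded ((ha.abs.add hb.abs).mul_left 2) fun n => ?_
    have h : ‖a n + b n‖ ^ 2 ≤ 2 * (‖a n‖ ^ 2 + ‖b n‖ ^ 2) := by
      have h1 := norm_add_le (a n) (b n)
      have h2 := norm_nonneg (a n + b n)
      nlinarith [sq_nonneg (‖a n‖ - ‖b n‖)]
    simp only [Pi.add_apply, Real.norm_eq_abs, abs_mul, abs_pow, abs_norm]
    nlinarith [mul_le_mul_of_nonneg_right h (abs_nonneg (w n))]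
  smul_mem' := by
    rintro c f ⟨a, ha0, ha, haf⟩
    refine ⟨c • a, fun n hn => by simp [ha0 n hn], ?_, fun s => (haf s).smul c⟩
    refine (ha.mul_left (‖c‖ ^ 2)).congr fun n => ?_
    simp only [Pi.smul_apply, smul_eq_mul, norm_mul]
    ring

/-- The Dirichlet coefficients of an element of `H_w`; see `HSpace.coeff_eq` for uniqueness. -/
noncomputable def HSpace.coeff {w : ℕ → ℝ} {n₀ : ℕ} (f : HSpace w n₀) : ℕ → ℂ :=
  Classical.choose f.2

/-- The coefficients of a function represented by a Dirichlet series on `Ω_{1/2}` are unique. -/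
theorem HSpace.coeff_eq {w : ℕ → ℝ} {n₀ : ℕ} (hn₀ : 1 ≤ n₀) (f : HSpace w n₀) {a : ℕ → ℂ}
    (ha0 : ∀ n < n₀, a n = 0)
    (haf : ∀ s : halfPlane (1 / 2), LSeriesHasSum a s (f.1 s)) : HSpace.coeff f = a := by
  obtain ⟨hb0, -, hbf⟩ := Classical.choose_spec f.2
  change (∀ n < n₀, HSpace.coeff f n = 0) at hb0
  change (∀ s : halfPlane (1 / 2), LSeriesHasSum (HSpace.coeff f) s (f.1 s)) at hbf
  have key : ∀ {c : ℕ → ℂ}, (∀ s : halfPlane (1 / 2), LSeriesHasSum c s (f.1 s)) →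
      LSeries.abscissaOfAbsConv c < ⊤ := fun {c} hc =>
    (hc ⟨1, by norm_num [halfPlane]⟩).LSeriesSummable.abscissaOfAbsConv_le.trans_lt
      (EReal.coe_lt_top _)
  funext n
  rcases eq_or_ne n 0 with rfl | hn
  · rw [hb0 0 hn₀, ha0 0 hn₀]
  · refine LSeries.eq_of_LSeries_eventually_eq (key hbf) (key haf) ?_ hn
    filter_upwards [eventually_gt_atTop (1 / 2 : ℝ)] with x hx
    have hx' : (x : ℂ) ∈ halfPlane (1 / 2) := by simpa [halfPlane] using! hx
    exact (hbf ⟨x, hx'⟩).LSeries_eq.trans (haf ⟨x, hx'⟩).LSeries_eq.symm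

/-- The norm of `H_w`: `‖f‖ = (∑_{n ≥ n₀} ‖a n‖ ^ 2 * w n) ^ (1 / 2)`, where the `a n` are the
Dirichlet coefficients of `f`. -/
noncomputable def HSpace.hnorm {w : ℕ → ℝ} {n₀ : ℕ} (f : HSpace w n₀) : ℝ :=
  Real.sqrt (∑' n, ‖HSpace.coeff f n‖ ^ 2 * w n)

/-! ### Multipliers of `H_w` -/

/-- The multiplier algebra of `H_w`: all functions `φ` on `Ω_{1/2}` such that `φ * f` is in `H_w`
for every `f` in `H_w`, with the pointwise operations. -/
def multiplierAlgebra (w : ℕ → ℝ) (n₀ : ℕ) : Subalgebra ℂ (halfPlane (1 / 2) → ℂ) where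
  carrier := {φ | ∀ f ∈ HSpace w n₀, φ * f ∈ HSpace w n₀}
  mul_mem' := by
    intro φ ψ hφ hψ f hf
    rw [mul_assoc]
    exact hφ _ (hψ _ hf)
  add_mem' := by
    intro φ ψ hφ hψ f hf
    rw [add_mul]
    exact (HSpace w n₀).add_mem (hφ _ hf) (hψ _ hf)
  algebraMap_mem' := by
    intro c f hf
    rw [← Algebra.smul_def]
    exact (HSpace w n₀).smul_mem c hf

/-- The operator `M_φ` of multiplication by a multiplier `φ`, as a linear map on `H_w`. -/
def mulOp {w : ℕ → ℝ} {n₀ : ℕ} (φ : multiplierAlgebra w n₀) : HSpace w n₀ →ₗ[ℂ] HSpace w n₀ where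
  toFun f := ⟨φ.1 * f.1, φ.2 f.1 f.2⟩
  map_add' f g := Subtype.ext (mul_add φ.1 f.1 g.1)
  map_smul' c f := Subtype.ext (mul_smul_comm c φ.1 f.1)

/-- `C` is a bound for the operator `M_φ`. -/
def IsMulBound {w : ℕ → ℝ} {n₀ : ℕ} (φ : multiplierAlgebra w n₀) (C : ℝ) : Prop :=
  0 ≤ C ∧ ∀ f : HSpace w n₀, HSpace.hnorm (mulOp φ f) ≤ C * HSpace.hnorm f

/-- The norm of a multiplier `φ`: the operator norm of `M_φ` on `H_w` (meaningful when `M_φ` is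
bounded). -/
noncomputable def multiplierNorm {w : ℕ → ℝ} {n₀ : ℕ} (φ : multiplierAlgebra w n₀) : ℝ :=
  sInf {C : ℝ | IsMulBound φ C}

/-! ### The algebra `H^∞(Ω_0) ∩ D` -/

/-- The class `D`: the function `φ` on `Ω_0` is represented in some half-plane by a (conditionally)
convergent Dirichlet series `∑_{n ≥ 1} a n * n ^ (-s)`. -/
def MemD (φ : halfPlane 0 → ℂ) : Prop :=
  ∃ (a : ℕ → ℂ) (ρ : ℝ), ∀ s : halfPlane 0, ρ < s.1.re →
    Tendsto (fun N : ℕ => ∑ n ∈ Finset.Icc 1 N, a n / (n : ℂ) ^ s.1) atTop (𝓝 (φ s))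

/-- A Dirichlet series that converges in some half-plane converges absolutely in some (smaller)
half-plane. -/
theorem memD_iff (φ : halfPlane 0 → ℂ) :
    MemD φ ↔ ∃ (a : ℕ → ℂ) (ρ : ℝ), ∀ s : halfPlane 0, ρ < s.1.re → LSeriesHasSum a s (φ s) := by
  have hsum : ∀ (a : ℕ → ℂ) (s : ℂ) (N : ℕ), ∑ n ∈ Finset.Icc 1 N, a n / (n : ℂ) ^ s =
      ∑ n ∈ Finset.range (N + 1), LSeries.term a s n := by
    intro a s N
    rw [Finset.range_eq_Ico, Finset.sum_eq_sum_Ico_succ_bot (Nat.succ_pos N)]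
    rw [LSeries.term_zero, zero_add]
    refine Finset.sum_congr rfl fun n hn => ?_
    rw [LSeries.term_of_ne_zero (by have := (Finset.mem_Icc.mp hn).1; omega)]
  constructor
  · rintro ⟨a, ρ, h⟩
    refine ⟨a, max ρ 0 + 2, fun s hs => ?_⟩
    have hm0 : 0 ≤ max ρ 0 := le_max_right _ _
    have hmρ : ρ ≤ max ρ 0 := le_max_left _ _
    set x : ℝ := max ρ 0 + 1 with hx
    have hx0 : (x : ℂ) ∈ halfPlane 0 := by
      have : (0 : ℝ) < x := by linarith
      simpa [halfPlane] using! this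
    have h1 := h ⟨x, hx0⟩ (by simp only [Complex.ofReal_re]; linarith)
    simp only [hsum] at h1
    have h2 : Tendsto (fun n => LSeries.term a x n) atTop (𝓝 0) := by
      have h3 := ((tendsto_add_atTop_iff_nat 1).mpr h1).sub h1
      rw [sub_self] at h3
      rw [← tendsto_add_atTop_iff_nat 1]
      refine h3.congr fun n => ?_
      rw [Finset.sum_range_succ _ (n + 1), add_sub_cancel_left]
    obtain ⟨C, hC⟩ := h2.norm.bddAbove_range
    have hs' : LSeriesSummable a s := by
      refine LSeriesSummable_of_le_const_mul_rpow (x := x + 1) (by linarith) ⟨C, fun n hn => ?_⟩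
      have h4 : ‖LSeries.term a x n‖ ≤ C := hC ⟨n, rfl⟩
      have hpos : (0 : ℝ) < (n : ℝ) ^ x :=
        Real.rpow_pos_of_pos (by exact_mod_cast Nat.pos_of_ne_zero hn) _
      rw [LSeries.norm_term_eq, if_neg hn, Complex.ofReal_re, div_le_iff₀ hpos] at h4
      simpa using h4
    have h5 := h s (by linarith)
    simp only [hsum] at h5
    have h6 := (tendsto_add_atTop_iff_nat 1).mpr hs'.LSeriesHasSum.tendsto_sum_nat
    rw [tendsto_nhds_unique h5 h6]
    exact hs'.LSeriesHasSum
  · rintro ⟨a, ρ, h⟩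
    refine ⟨a, ρ, fun s hs => ?_⟩
    simp only [hsum]
    exact (tendsto_add_atTop_iff_nat 1).mpr (h s hs).tendsto_sum_nat

/-- The algebra `H^∞(Ω_0) ∩ D`: all bounded holomorphic functions on `Ω_0` that are represented in
some half-plane by a Dirichlet series, with the pointwise operations. -/
def hInfD : Subalgebra ℂ (halfPlane 0 → ℂ) where
  carrier := {φ | (∃ F : ℂ → ℂ, DifferentiableOn ℂ F (halfPlane 0) ∧ ∀ s, φ s = F s) ∧
    (∃ C : ℝ, ∀ s, ‖φ s‖ ≤ C) ∧ MemD φ}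
  mul_mem' := by
    rintro φ ψ ⟨⟨F, hF, hφF⟩, ⟨C, hC⟩, hφ⟩ ⟨⟨G, hG, hψG⟩, ⟨C', hC'⟩, hψ⟩
    refine ⟨⟨F * G, hF.mul hG, fun s => by simp [hφF, hψG]⟩, ⟨C * C', fun s => ?_⟩, ?_⟩
    · rw [Pi.mul_apply, norm_mul]
      exact mul_le_mul (hC s) (hC' s) (norm_nonneg _) ((norm_nonneg _).trans (hC s))
    · obtain ⟨a, ρ, ha⟩ := (memD_iff φ).mp hφ
      obtain ⟨b, ρ', hb⟩ := (memD_iff ψ).mp hψ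
      exact (memD_iff _).mpr ⟨a ⍟ b, max ρ ρ', fun s hs =>
        (ha s ((le_max_left _ _).trans_lt hs)).convolution (hb s ((le_max_right _ _).trans_lt hs))⟩
  add_mem' := by
    rintro φ ψ ⟨⟨F, hF, hφF⟩, ⟨C, hC⟩, hφ⟩ ⟨⟨G, hG, hψG⟩, ⟨C', hC'⟩, hψ⟩
    refine ⟨⟨F + G, hF.add hG, fun s => by simp [hφF, hψG]⟩,
      ⟨C + C', fun s => (norm_add_le _ _).trans (add_le_add (hC s) (hC' s))⟩, ?_⟩
    obtain ⟨a, ρ, ha⟩ := (memD_iff φ).mp hφ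
    obtain ⟨b, ρ', hb⟩ := (memD_iff ψ).mp hψ
    exact (memD_iff _).mpr ⟨a + b, max ρ ρ', fun s hs =>
      (ha s ((le_max_left _ _).trans_lt hs)).add (hb s ((le_max_right _ _).trans_lt hs))⟩
  algebraMap_mem' := by
    intro c
    refine ⟨⟨fun _ => c, differentiableOn_const c, fun s => rfl⟩, ⟨‖c‖, fun s => le_rfl⟩, ?_⟩
    refine (memD_iff _).mpr ⟨c • LSeries.delta, 0, fun s _ => ?_⟩
    have h : LSeriesHasSum LSeries.delta s.1 1 := by
      have h1 : LSeries.term LSeries.delta s.1 = fun n => if n = 1 then 1 else 0 :=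
        funext fun n => LSeries.term_delta s.1 n
      rw [LSeriesHasSum, h1]
      exact hasSum_ite_eq 1 1
    have h2 := h.smul c
    rw [mul_one] at h2
    exact h2

/-- The supremum of `|φ|` on `Ω_0`, for `φ` in `H^∞(Ω_0) ∩ D`. -/
noncomputable def hInfNorm (φ : hInfD) : ℝ := ⨆ s : halfPlane 0, ‖φ.1 s‖

/-! ### The weights and the identification -/

/-- The weights `w n = ∫ n ^ (-2 σ) dμ(σ)` attached to a measure `μ` on `[0, ∞)`. -/
noncomputable def momentWeight (μ : Measure ℝ≥0) (n : ℕ) : ℝ :=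
  ∫ σ : ℝ≥0, (n : ℝ) ^ (-2 * (σ : ℝ)) ∂μ

/-- Every multiplication operator on `H_w` is bounded, and the multiplier algebra of `H_w`, with the
operator norm, is isometrically isomorphic to `H^∞(Ω_0) ∩ D`, with the supremum norm, by an algebra
isomorphism that sends a multiplier to its extension to `Ω_0`. -/
def MultiplierAlgebraIsHInfD (w : ℕ → ℝ) (n₀ : ℕ) : Prop :=
  (∀ φ : multiplierAlgebra w n₀, ∃ C, IsMulBound φ C) ∧
  ∃ e : multiplierAlgebra w n₀ ≃ₐ[ℂ] hInfD,
    (∀ (φ : multiplierAlgebra w n₀) (s : halfPlane (1 / 2)), (e φ).1 (halfPlaneIncl s) = φ.1 s) ∧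
    ∀ φ : multiplierAlgebra w n₀, hInfNorm (e φ) = multiplierNorm φ

end DirichletHilbert

namespace DirichletHilbert

/-! ### Mean values on vertical lines -/

/-! Multiplication by φ acts on coefficients as Dirichlet convolution by the coefficients `b` of φ,
so the theorem compares the norm of that convolution with the supremum of |φ| on Ω_0. Only two
properties of the weights enter: `SlowDecay` (for a moment weight, from 0 lying in the support) and
`IsAverage` (from the integral representation).

Bounded functions are multipliers. If |F| ≤ K on Ω_0, the entry b(k/n) of the convolution matrix is
the mean value of F(s)(k/n)^s on every line Re s = σ > 0: this is clear far to the right, where the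
series converges absolutely, and Cauchy's theorem moves the line (`tendsto_symmMean_of_bounded`).
The sesquilinear form of the matrix is therefore a mean of F against two Dirichlet polynomials;
orthogonality of the n^(-it) and σ → 0 bound it by K on ℓ² (`sum_norm_convolution_sq_le`).
Translating F by σ gives the same bound for the weights n^(-2σ), and averaging over σ gives it for w
(`IsAverage.isConvBound`).

Multipliers extend. The products of φ with n₀^(-s) and (n₀+1)^(-s) force φ to be a Dirichlet series
(`exists_lseriesHasSum_of_multiplier`), and the closed graph theorem gives a bound C. The j-th
convolution power of `b`, applied to the basis vector at n₀, has squared norm at most C^(2j) w(n₀).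
Truncation to N-smooth numbers is multiplicative, and on truncated series evaluation at any s in Ω_0
is bounded, because the sum of n^(-σ) over smooth n is a finite Euler product. Hence the truncation
φ_N satisfies |φ_N(s)|^j ≤ B C^j with B independent of j, so |φ_N(s)| ≤ C. The φ_N converge
uniformly to φ on Re s ≥ 1, and the three lines theorem carries convergence to all of Ω_0
(`exists_bounded_extension`, `IsConvBound.exists_extension`). The two directions together give
equality of norms. -/

/-- The mean value of `g` over the interval `[-T, T]`. -/
noncomputable def symmMean (g : ℝ → ℂ) (T : ℝ) : ℂ := (2 * T : ℂ)⁻¹ * ∫ t in -T..T, g t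

theorem norm_symmMean_le {g : ℝ → ℂ} {C T : ℝ} (hT : 0 < T) (hg : ∀ t, ‖g t‖ ≤ C) :
    ‖symmMean g T‖ ≤ C := by
  have h := intervalIntegral.norm_integral_le_of_norm_le_const (a := -T) (b := T) (f := g)
    fun t _ => hg t
  rw [symmMean, norm_mul, norm_inv, norm_mul, Complex.norm_two, Complex.norm_real,
    Real.norm_of_nonneg hT.le, inv_mul_le_iff₀ (by positivity)]
  rw [abs_of_pos (by linarith)] at h
  linarith

/-- At nonzero frequency the antiderivative is bounded, so the mean is O(1/T). This is the
orthogonality relation behind all later mean values. -/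
theorem tendsto_symmMean_exp (lam : ℝ) :
    Tendsto (symmMean fun t => Complex.exp (lam * t * Complex.I)) atTop
      (𝓝 (if lam = 0 then 1 else 0)) := by
  split_ifs with h
  · refine tendsto_const_nhds.congr' ?_
    filter_upwards [eventually_gt_atTop 0] with T hT
    have : (T : ℂ) ≠ 0 := by exact_mod_cast hT.ne'
    simp only [symmMean, h, Complex.ofReal_zero, zero_mul, Complex.exp_zero,
      intervalIntegral.integral_const, sub_neg_eq_add, Complex.real_smul, Complex.ofReal_add,
      mul_one]
    field_simp
    norm_num
  · have hl : (lam : ℂ) * Complex.I ≠ 0 := by simp [h]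
    rw [tendsto_zero_iff_norm_tendsto_zero]
    refine squeeze_zero' (g := fun T => |lam|⁻¹ * T⁻¹) (Eventually.of_forall fun _ => norm_nonneg _)
      ?_ (by simpa using tendsto_inv_atTop_zero.const_mul (|lam|⁻¹))
    filter_upwards [eventually_gt_atTop 0] with T hT
    have h1 : (∫ t in -T..T, Complex.exp (lam * t * Complex.I)) =
        (Complex.exp (lam * Complex.I * T) - Complex.exp (lam * Complex.I * (-T : ℝ))) /
          (lam * Complex.I) := by
      rw [← integral_exp_mul_complex hl]
      exact intervalIntegral.integral_congr fun t _ => by ring_nf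
    have h2 : ‖Complex.exp (lam * Complex.I * T) - Complex.exp (lam * Complex.I * (-T : ℝ))‖
        ≤ 2 := by
      refine (norm_sub_le _ _).trans ?_
      simp [Complex.norm_exp]
      norm_num
    rw [symmMean, h1, norm_mul, norm_inv, norm_mul, Complex.norm_two, Complex.norm_real,
      Real.norm_of_nonneg hT.le, norm_div, norm_mul, Complex.norm_I, mul_one, Complex.norm_real,
      Real.norm_eq_abs]
    calc (2 * T)⁻¹ * (_ / |lam|) ≤ (2 * T)⁻¹ * (2 / |lam|) := by gcongr
      _ = _ := by field_simp

theorem symmMean_finset_sum {ι : Type*} (s : Finset ι) (g : ι → ℝ → ℂ)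
    (hg : ∀ i ∈ s, Continuous (g i)) (T : ℝ) :
    symmMean (fun t => ∑ i ∈ s, g i t) T = ∑ i ∈ s, symmMean (g i) T := by
  simp only [symmMean]
  rw [intervalIntegral.integral_finsetSum fun i hi => (hg i hi).intervalIntegrable _ _,
    Finset.mul_sum]

theorem symmMean_const_mul (c : ℂ) (g : ℝ → ℂ) (T : ℝ) :
    symmMean (fun t => c * g t) T = c * symmMean g T := by
  simp only [symmMean]
  rw [intervalIntegral.integral_const_mul]
  ring

/-- The mean value of the squared modulus of a Dirichlet polynomial. -/
theorem tendsto_symmMean_normSq (N : ℕ) (x : ℕ → ℂ) :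
    Tendsto (symmMean fun t => ((‖∑ n ∈ Finset.Icc 1 N,
      x n * Complex.exp ((-Real.log n : ℝ) * t * Complex.I)‖ ^ 2 : ℝ) : ℂ)) atTop
      (𝓝 ((∑ n ∈ Finset.Icc 1 N, ‖x n‖ ^ 2 : ℝ) : ℂ)) := by
  have h1 : ∀ t : ℝ, ((‖∑ n ∈ Finset.Icc 1 N,
      x n * Complex.exp ((-Real.log n : ℝ) * t * Complex.I)‖ ^ 2 : ℝ) : ℂ) =
      ∑ n ∈ Finset.Icc 1 N, ∑ m ∈ Finset.Icc 1 N, x n * starRingEnd ℂ (x m) *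
        Complex.exp ((Real.log m - Real.log n : ℝ) * t * Complex.I) := by
    intro t
    rw [Complex.ofReal_pow, ← Complex.mul_conj', map_sum, Finset.sum_mul_sum]
    refine Finset.sum_congr rfl fun n _ => Finset.sum_congr rfl fun m _ => ?_
    rw [map_mul, ← Complex.exp_conj, mul_mul_mul_comm, ← Complex.exp_add]
    congr 2
    simp only [map_mul, Complex.conj_ofReal, Complex.conj_I]
    push_cast
    ring
  have h2 : symmMean (fun t => ((‖∑ n ∈ Finset.Icc 1 N,
      x n * Complex.exp ((-Real.log n : ℝ) * t * Complex.I)‖ ^ 2 : ℝ) : ℂ)) = fun T =>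
      ∑ n ∈ Finset.Icc 1 N, ∑ m ∈ Finset.Icc 1 N, x n * starRingEnd ℂ (x m) *
        symmMean (fun t => Complex.exp ((Real.log m - Real.log n : ℝ) * t * Complex.I)) T := by
    funext T
    simp only [h1]
    rw [symmMean_finset_sum _ _ fun n _ => by fun_prop]
    refine Finset.sum_congr rfl fun n _ => ?_
    rw [symmMean_finset_sum _ _ fun m _ => by fun_prop]
    exact Finset.sum_congr rfl fun m _ => symmMean_const_mul _ _ _
  have h3 : ((∑ n ∈ Finset.Icc 1 N, ‖x n‖ ^ 2 : ℝ) : ℂ) =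
      ∑ n ∈ Finset.Icc 1 N, ∑ m ∈ Finset.Icc 1 N, x n * starRingEnd ℂ (x m) *
        (if Real.log m - Real.log n = 0 then 1 else 0) := by
    push_cast
    refine Finset.sum_congr rfl fun n hn => ?_
    rw [Finset.sum_eq_single_of_mem n hn, if_pos (sub_self _), mul_one, Complex.mul_conj']
    intro m hm hmn
    rw [if_neg, mul_zero]
    intro h
    refine hmn (Nat.cast_injective (R := ℝ) (Real.log_injOn_pos ?_ ?_ (sub_eq_zero.mp h)))
    · exact Set.mem_Ioi.mpr (by exact_mod_cast (Finset.mem_Icc.mp hm).1)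
    · exact Set.mem_Ioi.mpr (by exact_mod_cast (Finset.mem_Icc.mp hn).1)
  rw [h2, h3]
  exact tendsto_finsetSum _ fun n _ => tendsto_finsetSum _ fun m _ =>
    (tendsto_symmMean_exp _).const_mul _

/-- The `(k, n)` entry of the matrix of Dirichlet convolution by `b`. -/
noncomputable def convEntry (b : ℕ → ℂ) (k n : ℕ) : ℂ := if n ∣ k then b (k / n) else 0

theorem convolution_eq_sum_convEntry (b a : ℕ → ℂ) {k N : ℕ} (hk : k ∈ Finset.Icc 1 N) :
    (b ⍟ a) k = ∑ n ∈ Finset.Icc 1 N, convEntry b k n * a n := by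
  obtain ⟨hk1, hkN⟩ := Finset.mem_Icc.mp hk
  rw [LSeries.convolution_def]
  simp only
  rw [Nat.sum_divisorsAntidiagonal' (f := fun i j => b i * a j)]
  simp only [convEntry, ite_mul, zero_mul]
  rw [← Finset.sum_filter]
  refine Finset.sum_congr ?_ fun _ _ => rfl
  ext n
  simp only [Nat.mem_divisors, Finset.mem_filter, Finset.mem_Icc]
  constructor
  · rintro ⟨h, h0⟩
    exact ⟨⟨Nat.pos_of_dvd_of_pos h hk1, (Nat.le_of_dvd hk1 h).trans hkN⟩, h⟩
  · rintro ⟨-, h⟩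
    exact ⟨h, by omega⟩

/-- The mean value of an absolutely convergent Dirichlet series against `(k / n) ^ s`. -/
theorem tendsto_symmMean_LSeries {b : ℕ → ℂ} {σ : ℝ} (hb : LSeriesSummable b σ) {k n : ℕ}
    (hk : k ≠ 0) (hn : n ≠ 0) :
    Tendsto (symmMean fun t => LSeries b (σ + t * Complex.I) *
      Complex.exp ((Real.log k - Real.log n : ℝ) * (σ + t * Complex.I))) atTop
      (𝓝 (convEntry b k n)) := by
  set lam : ℝ := Real.log k - Real.log n with hlam
  set E : ℂ := Complex.exp (lam * σ) with hE
  set u : ℕ → ℂ := fun m => LSeries.term b σ m * E with hu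
  have hus : Summable fun m => ‖u m‖ := (hb.mul_right E).norm
  have h1 : ∀ (t : ℝ) (m : ℕ), LSeries.term b (σ + t * Complex.I) m *
      Complex.exp (lam * (σ + t * Complex.I)) =
      u m * Complex.exp ((lam - Real.log m : ℝ) * t * Complex.I) := by
    intro t m
    rcases eq_or_ne m 0 with rfl | hm
    · simp [hu]
    · have hm' : (m : ℂ) ≠ 0 := by exact_mod_cast hm
      have e1 : Complex.exp (lam * (σ + t * Complex.I)) =
          E * Complex.exp (lam * t * Complex.I) := by
        rw [hE, ← Complex.exp_add]; ring_nf
      have e2 : (m : ℂ) ^ ((t : ℂ) * Complex.I) = Complex.exp (Real.log m * t * Complex.I) := by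
        rw [Complex.cpow_def_of_ne_zero hm', Complex.natCast_log, mul_assoc]
      have e3 : Complex.exp ((lam - Real.log m : ℝ) * t * Complex.I) =
          Complex.exp (lam * t * Complex.I) / Complex.exp (Real.log m * t * Complex.I) := by
        rw [← Complex.exp_sub]; push_cast; ring_nf
      simp only [hu]
      rw [LSeries.term_of_ne_zero hm, LSeries.term_of_ne_zero hm, Complex.cpow_add _ _ hm', e1, e2,
        e3]
      ring
  have h2 : ∀ T : ℝ, HasSum (fun m => u m *
      symmMean (fun t => Complex.exp ((lam - Real.log m : ℝ) * t * Complex.I)) T)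
      (symmMean (fun t => LSeries b (σ + t * Complex.I) *
        Complex.exp (lam * (σ + t * Complex.I))) T) := by
    intro T
    have h3 := intervalIntegral.hasSum_integral_of_dominated_convergence (μ := volume)
      (a := -T) (b := T) (fun m _ => ‖u m‖)
      (F := fun m t => u m * Complex.exp ((lam - Real.log m : ℝ) * t * Complex.I))
      (f := fun t => LSeries b (σ + t * Complex.I) *
        Complex.exp (lam * (σ + t * Complex.I)))
      (fun m => (by fun_prop : Continuous _).aestronglyMeasurable)
      (fun m => Eventually.of_forall fun t _ => by
        rw [norm_mul, ← Complex.ofReal_mul, Complex.norm_exp_ofReal_mul_I, mul_one])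
      (Eventually.of_forall fun t _ => hus) (by simp)
      (Eventually.of_forall fun t _ => by
        have h4 : LSeriesSummable b (σ + t * Complex.I) :=
          LSeriesSummable.of_re_le_re (s := σ) (by simp) hb
        simp only [← h1]
        exact h4.LSeriesHasSum.mul_right _)
    have h5 := h3.mul_left (2 * T : ℂ)⁻¹
    simp only [← symmMean_const_mul]
    exact h5
  have h3 : Tendsto (fun T => ∑' m, u m *
      symmMean (fun t => Complex.exp ((lam - Real.log m : ℝ) * t * Complex.I)) T) atTop
      (𝓝 (∑' m, u m * (if lam - Real.log m = 0 then 1 else 0))) := by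
    refine tendsto_tsum_of_dominated_convergence hus
      (fun m => (tendsto_symmMean_exp _).const_mul _) ?_
    filter_upwards [eventually_gt_atTop 0] with T hT m
    rw [norm_mul]
    refine mul_le_of_le_one_right (norm_nonneg _) (norm_symmMean_le hT fun t => ?_)
    rw [← Complex.ofReal_mul, Complex.norm_exp_ofReal_mul_I]
  have h4 : ∑' m, u m * (if lam - Real.log m = 0 then 1 else 0) = convEntry b k n := by
    have hk' : (0 : ℝ) < k := by positivity
    have hn' : (0 : ℝ) < n := by positivity
    -- Only the zero frequency survives in the mean, and it selects the index m = k/n.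
    have key : ∀ m : ℕ, m ≠ 0 → (lam - Real.log m = 0 ↔ k = n * m) := by
      intro m hm
      have hm' : (0 : ℝ) < m := by positivity
      rw [hlam, sub_sub, ← Real.log_mul hn'.ne' hm'.ne', sub_eq_zero]
      constructor
      · intro h
        exact_mod_cast Real.log_injOn_pos hk' (by positivity : (0 : ℝ) < n * m) h
      · intro h
        rw [h]; push_cast; rfl
    rw [tsum_eq_single (k / n)]
    · rw [convEntry]
      by_cases hd : n ∣ k
      · have hm0 : k / n ≠ 0 := (Nat.div_pos (Nat.le_of_dvd (by omega) hd) (by omega)).ne'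
        have hkm := (Nat.mul_div_cancel' hd).symm
        have hl := (key _ hm0).mpr hkm
        rw [if_pos hl, if_pos hd, mul_one]
        simp only [hu, hE]
        have hm' : ((k / n : ℕ) : ℂ) ≠ 0 := by exact_mod_cast hm0
        rw [LSeries.term_of_ne_zero hm0, Complex.cpow_def_of_ne_zero hm', ← Complex.natCast_log,
          sub_eq_zero.mp hl, div_mul_cancel₀ _ (Complex.exp_ne_zero _)]
      · rw [if_neg hd]
        rcases eq_or_ne (k / n) 0 with h0 | h0
        · simp [hu, h0]
        · rw [if_neg, mul_zero]
          exact fun h => hd ⟨_, (key _ h0).mp h⟩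
    · intro m hm
      rcases eq_or_ne m 0 with rfl | h0
      · simp [hu]
      · rw [if_neg, mul_zero]
        intro h
        exact hm (Nat.div_eq_of_eq_mul_right (by omega) ((key m h0).mp h)).symm
  rw [← h4]
  exact h3.congr fun T => (h2 T).tsum_eq

/-- Mean values of a bounded holomorphic function on `Ω_0` do not depend on the vertical line. -/
theorem tendsto_symmMean_sub {F : ℂ → ℂ} (hF : DifferentiableOn ℂ F (halfPlane 0)) {K : ℝ}
    (hK : ∀ s ∈ halfPlane 0, ‖F s‖ ≤ K) {σ τ : ℝ} (hσ : 0 < σ) (hτ : σ ≤ τ) (lam : ℝ) :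
    Tendsto (fun T => symmMean (fun t => F (τ + t * Complex.I) *
        Complex.exp (lam * (τ + t * Complex.I))) T -
      symmMean (fun t => F (σ + t * Complex.I) *
        Complex.exp (lam * (σ + t * Complex.I))) T) atTop (𝓝 0) := by
  set G : ℂ → ℂ := fun s => F s * Complex.exp (lam * s) with hG
  have hK0 : 0 ≤ K := (norm_nonneg _).trans (hK 1 (by simp [halfPlane]))
  have hGd : DifferentiableOn ℂ G (halfPlane 0) := hF.mul (by fun_prop)
  set C : ℝ := K * Real.exp (|lam| * τ) with hC
  have hGb : ∀ x ∈ Set.Icc σ τ, ∀ y : ℝ, ‖G (x + y * Complex.I)‖ ≤ C := by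
    intro x hx y
    rw [hG, hC]
    simp only [norm_mul]
    refine mul_le_mul (hK _ ?_) ?_ (norm_nonneg _) hK0
    · simpa [halfPlane] using hσ.trans_le hx.1
    · rw [Complex.norm_exp]
      refine Real.exp_le_exp.mpr ?_
      simp only [Complex.mul_re, Complex.ofReal_re, Complex.add_re, Complex.ofReal_im,
        Complex.I_re, Complex.I_im, zero_mul, mul_zero, sub_zero, add_zero, mul_one]
      exact (mul_le_mul_of_nonneg_right (le_abs_self _) (hσ.le.trans hx.1)).trans
        (mul_le_mul_of_nonneg_left hx.2 (abs_nonneg _))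
  rw [tendsto_zero_iff_norm_tendsto_zero]
  refine squeeze_zero' (g := fun T => C * (τ - σ) * T⁻¹)
    (Eventually.of_forall fun _ => norm_nonneg _) ?_
    (by simpa using tendsto_inv_atTop_zero.const_mul (C * (τ - σ)))
  filter_upwards [eventually_gt_atTop 0] with T hT
  -- Cauchy's theorem on the rectangle with vertical sides on Re s = σ and Re s = τ. The horizontal
  -- sides contribute at most C(τ - σ) each, uniformly in T, so division by 2T makes the difference
  -- O(1/T).
  have h1 := Complex.integral_boundary_rect_eq_zero_of_differentiableOn G (σ + (-T : ℝ) * Complex.I)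
    (τ + T * Complex.I) (hGd.mono (by
      intro s hs
      rw [Complex.mem_reProdIm] at hs
      simp only [Complex.add_re, Complex.ofReal_re, Complex.mul_re, Complex.I_re, mul_zero,
        Complex.ofReal_im, Complex.I_im, sub_zero, add_zero, mul_one] at hs
      rw [Set.uIcc_of_le hτ] at hs
      exact hσ.trans_le hs.1.1))
  simp only [Complex.add_re, Complex.ofReal_re, Complex.mul_re, Complex.I_re, mul_zero,
    Complex.ofReal_im, Complex.I_im, sub_zero, add_zero, mul_one, Complex.add_im,
    Complex.mul_im, zero_add, smul_eq_mul] at h1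
  have hb : ∀ y : ℝ, ‖∫ x in σ..τ, G (x + y * Complex.I)‖ ≤ C * (τ - σ) := by
    intro y
    have := intervalIntegral.norm_integral_le_of_norm_le_const (a := σ) (b := τ)
      (f := fun x : ℝ => G (x + y * Complex.I)) (C := C) fun x hx => by
        rw [Set.uIoc_of_le hτ] at hx
        exact hGb x ⟨hx.1.le, hx.2⟩ y
    rwa [abs_of_nonneg (by linarith)] at this
  have h2 : (∫ t in -T..T, G (τ + t * Complex.I)) - ∫ t in -T..T, G (σ + t * Complex.I) =
      Complex.I * ((∫ x in σ..τ, G (x + (-T : ℝ) * Complex.I)) -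
        ∫ x in σ..τ, G (x + T * Complex.I)) := by
    linear_combination (-Complex.I) * h1 + ((∫ t in -T..T, G (τ + t * Complex.I)) -
      ∫ t in -T..T, G (σ + t * Complex.I)) * Complex.I_mul_I
  simp only [symmMean]
  rw [← mul_sub]
  change ‖_ * ((∫ t in -T..T, G (τ + t * Complex.I)) - ∫ t in -T..T, G (σ + t * Complex.I))‖ ≤ _
  rw [h2, norm_mul, norm_mul, norm_inv, norm_mul, Complex.norm_two, Complex.norm_real,
    Real.norm_of_nonneg hT.le, Complex.norm_I, one_mul, inv_mul_le_iff₀ (by positivity)]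
  calc _ ≤ C * (τ - σ) + C * (τ - σ) := (norm_sub_le _ _).trans (add_le_add (hb _) (hb _))
    _ = _ := by field_simp; ring

/-! ### From the supremum of a function on Ω_0 to ℓ² bounds for convolution. -/

theorem mem_halfPlane_vertical {σ : ℝ} (hσ : 0 < σ) (t : ℝ) :
    (σ + t * Complex.I : ℂ) ∈ halfPlane 0 := by
  simpa [halfPlane] using hσ

/-- The mean value, on an arbitrary vertical line in `Ω_0`, of a bounded holomorphic function
represented by a Dirichlet series somewhere. -/
theorem tendsto_symmMean_of_bounded {F : ℂ → ℂ} (hF : DifferentiableOn ℂ F (halfPlane 0)) {K : ℝ}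
    (hK : ∀ s ∈ halfPlane 0, ‖F s‖ ≤ K) {b : ℕ → ℂ} {ρ : ℝ}
    (hb : ∀ s ∈ halfPlane 0, ρ < s.re → LSeriesHasSum b s (F s)) {σ : ℝ} (hσ : 0 < σ) {k n : ℕ}
    (hk : k ≠ 0) (hn : n ≠ 0) :
    Tendsto (symmMean fun t => F (σ + t * Complex.I) *
      Complex.exp ((Real.log k - Real.log n : ℝ) * (σ + t * Complex.I))) atTop
      (𝓝 (convEntry b k n)) := by
  -- A line to the right of both σ and ρ, where the series converges absolutely.
  set τ : ℝ := max σ (ρ + 1) with hτ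
  have hτσ : σ ≤ τ := le_max_left _ _
  have hτρ : ρ < τ := (lt_add_one ρ).trans_le (le_max_right _ _)
  have hsum : ∀ t : ℝ, LSeriesHasSum b (τ + t * Complex.I) (F (τ + t * Complex.I)) := fun t =>
    hb _ (mem_halfPlane_vertical (hσ.trans_le hτσ) t) (by simpa using hτρ)
  have h1 := tendsto_symmMean_LSeries (b := b) (σ := τ)
    (by simpa using (hsum 0).LSeriesSummable) hk hn
  simp only [fun t => (hsum t).LSeries_eq] at h1
  simpa using h1.sub (tendsto_symmMean_sub hF hK hσ hτσ (Real.log k - Real.log n))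

/-- The left side is the norm of the mean of F times conj(h) f on Re s = σ, with Dirichlet
polynomials f and h. Bounding |F| by K and using 2|hf| ≤ |f|² + |h|² leaves two mean squares,
computed by orthogonality. The line must stay inside Ω_0, which produces the factors n^(-σ) and n^σ;
they disappear as σ → 0. -/
theorem norm_sum_convEntry_le_of_pos {F : ℂ → ℂ} (hF : DifferentiableOn ℂ F (halfPlane 0)) {K : ℝ}
    (hK : ∀ s ∈ halfPlane 0, ‖F s‖ ≤ K) {b : ℕ → ℂ} {ρ : ℝ}
    (hb : ∀ s ∈ halfPlane 0, ρ < s.re → LSeriesHasSum b s (F s)) {σ : ℝ} (hσ : 0 < σ) (N : ℕ)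
    (a d : ℕ → ℂ) :
    ‖∑ k ∈ Finset.Icc 1 N, ∑ n ∈ Finset.Icc 1 N, starRingEnd ℂ (d k) * a n * convEntry b k n‖ ≤
      K / 2 * ((∑ n ∈ Finset.Icc 1 N, ‖a n * Real.exp (-(σ * Real.log n))‖ ^ 2) +
        ∑ n ∈ Finset.Icc 1 N, ‖d n * Real.exp (σ * Real.log n)‖ ^ 2) := by
  have hK0 : 0 ≤ K := (norm_nonneg _).trans (hK 1 (by simp [halfPlane]))
  set f : ℝ → ℂ := fun t => ∑ n ∈ Finset.Icc 1 N, a n * Real.exp (-(σ * Real.log n)) *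
    Complex.exp ((-Real.log n : ℝ) * t * Complex.I) with hf
  set h : ℝ → ℂ := fun t => ∑ n ∈ Finset.Icc 1 N, d n * Real.exp (σ * Real.log n) *
    Complex.exp ((-Real.log n : ℝ) * t * Complex.I) with hh
  have hFc : Continuous fun t : ℝ => F (σ + t * Complex.I) :=
    hF.continuousOn.comp_continuous (by fun_prop) (mem_halfPlane_vertical hσ)
  have h1 : ∀ t : ℝ, F (σ + t * Complex.I) * (starRingEnd ℂ (h t) * f t) =
      ∑ k ∈ Finset.Icc 1 N, ∑ n ∈ Finset.Icc 1 N, starRingEnd ℂ (d k) * a n *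
        (F (σ + t * Complex.I) *
          Complex.exp ((Real.log k - Real.log n : ℝ) * (σ + t * Complex.I))) := by
    intro t
    rw [hf, hh, map_sum, Finset.sum_mul_sum, Finset.mul_sum]
    refine Finset.sum_congr rfl fun k _ => ?_
    rw [Finset.mul_sum]
    refine Finset.sum_congr rfl fun n _ => ?_
    -- Splits (k/n)^(σ+it) into k^σ k^(it), which goes to conj(h), and n^(-σ) n^(-it), which goes to
    -- f.
    have e1 : Complex.exp ((Real.log k - Real.log n : ℝ) * (σ + t * Complex.I)) =
        Complex.exp (σ * Real.log k) * Complex.exp (Real.log k * t * Complex.I) *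
        (Complex.exp (-(σ * Real.log n)) * Complex.exp (-Real.log n * t * Complex.I)) := by
      simp only [← Complex.exp_add]
      push_cast
      ring_nf
    have e2 : starRingEnd ℂ (Complex.exp ((-Real.log k : ℝ) * t * Complex.I)) =
        Complex.exp (Real.log k * t * Complex.I) := by
      rw [← Complex.exp_conj]
      congr 1
      simp only [map_mul, Complex.conj_ofReal, Complex.conj_I]
      push_cast
      ring
    rw [e1, map_mul, map_mul, e2, Complex.conj_ofReal]
    push_cast
    ring
  have h2 : Tendsto (symmMean fun t => F (σ + t * Complex.I) * (starRingEnd ℂ (h t) * f t)) atTop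
      (𝓝 (∑ k ∈ Finset.Icc 1 N, ∑ n ∈ Finset.Icc 1 N,
        starRingEnd ℂ (d k) * a n * convEntry b k n)) := by
    have e : (symmMean fun t => F (σ + t * Complex.I) * (starRingEnd ℂ (h t) * f t)) = fun T =>
        ∑ k ∈ Finset.Icc 1 N, ∑ n ∈ Finset.Icc 1 N, starRingEnd ℂ (d k) * a n *
          symmMean (fun t => F (σ + t * Complex.I) *
            Complex.exp ((Real.log k - Real.log n : ℝ) * (σ + t * Complex.I))) T := by
      funext T
      simp only [h1]
      have hc : ∀ k n : ℕ, Continuous fun t : ℝ => starRingEnd ℂ (d k) * a n *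
          (F (σ + t * Complex.I) *
            Complex.exp ((Real.log k - Real.log n : ℝ) * (σ + t * Complex.I))) := fun k n =>
        continuous_const.mul (hFc.mul (by fun_prop))
      rw [symmMean_finset_sum _ _ fun k _ => continuous_finsetSum _ fun n _ => hc k n]
      refine Finset.sum_congr rfl fun k _ => ?_
      rw [symmMean_finset_sum _ _ fun n _ => hc k n]
      exact Finset.sum_congr rfl fun m _ => symmMean_const_mul _ _ _
    rw [e]
    refine tendsto_finsetSum _ fun k hk => tendsto_finsetSum _ fun n hn =>
      (tendsto_symmMean_of_bounded hF hK hb hσ ?_ ?_).const_mul _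
    · have := (Finset.mem_Icc.mp hk).1; omega
    · have := (Finset.mem_Icc.mp hn).1; omega
  have hfc : Continuous f := by fun_prop
  have hhc : Continuous h := by fun_prop
  have h3 := ((tendsto_symmMean_normSq N fun n => a n * Real.exp (-(σ * Real.log n))).add
    (tendsto_symmMean_normSq N fun n => d n * Real.exp (σ * Real.log n))).const_mul (K / 2 : ℂ)
  have h4 := (Complex.continuous_re.tendsto _).comp h3
  have e4 : (K / 2 : ℂ) *
      (((∑ n ∈ Finset.Icc 1 N, ‖a n * Real.exp (-(σ * Real.log n))‖ ^ 2 : ℝ) : ℂ) +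
      ((∑ n ∈ Finset.Icc 1 N, ‖d n * Real.exp (σ * Real.log n)‖ ^ 2 : ℝ) : ℂ)) =
      ((K / 2 * ((∑ n ∈ Finset.Icc 1 N, ‖a n * Real.exp (-(σ * Real.log n))‖ ^ 2) +
        ∑ n ∈ Finset.Icc 1 N, ‖d n * Real.exp (σ * Real.log n)‖ ^ 2) : ℝ) : ℂ) := by
    push_cast
    ring
  rw [e4, Complex.ofReal_re] at h4
  refine le_of_tendsto_of_tendsto h2.norm h4 ?_
  filter_upwards [eventually_gt_atTop 0] with T hT
  have e5 : ((2 * T : ℂ))⁻¹ = (((2 * T)⁻¹ : ℝ) : ℂ) := by push_cast; rfl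
  simp only [Function.comp, symmMean]
  rw [intervalIntegral.integral_ofReal, intervalIntegral.integral_ofReal, e5, ← Complex.ofReal_mul,
    ← Complex.ofReal_mul, ← Complex.ofReal_add, ← Complex.ofReal_ofNat, ← Complex.ofReal_div,
    ← Complex.ofReal_mul, Complex.ofReal_re, ← mul_add]
  change _ ≤ K / 2 * ((2 * T)⁻¹ * ((∫ t in -T..T, ‖f t‖ ^ 2) + ∫ t in -T..T, ‖h t‖ ^ 2))
  rw [← intervalIntegral.integral_add (f := fun t => ‖f t‖ ^ 2) (g := fun t => ‖h t‖ ^ 2)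
      ((hfc.norm.pow 2).intervalIntegrable _ _) ((hhc.norm.pow 2).intervalIntegrable _ _),
    mul_left_comm, norm_mul, ← intervalIntegral.integral_const_mul (K / 2), Complex.norm_real,
    Real.norm_of_nonneg (by positivity)]
  refine mul_le_mul_of_nonneg_left ?_ (by positivity)
  refine intervalIntegral.norm_integral_le_of_norm_le (by linarith)
    (Eventually.of_forall fun t _ => ?_)
    ((((hfc.norm.pow 2).add (hhc.norm.pow 2)).const_smul (K / 2)).intervalIntegrable _ _)
  rw [norm_mul, norm_mul, RCLike.norm_conj]
  calc _ ≤ K * (‖h t‖ * ‖f t‖) :=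
        mul_le_mul_of_nonneg_right (hK _ (mem_halfPlane_vertical hσ t)) (by positivity)
    _ ≤ K / 2 * (‖f t‖ ^ 2 + ‖h t‖ ^ 2) := by
        nlinarith [mul_nonneg hK0 (sq_nonneg (‖h t‖ - ‖f t‖))]

/-- Dirichlet convolution by the coefficients of a function in `H^∞(Ω_0) ∩ D` is bounded on `ℓ²`. -/
theorem sum_norm_convolution_sq_le {F : ℂ → ℂ} (hF : DifferentiableOn ℂ F (halfPlane 0)) {K : ℝ}
    (hK : ∀ s ∈ halfPlane 0, ‖F s‖ ≤ K) {b : ℕ → ℂ} {ρ : ℝ}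
    (hb : ∀ s ∈ halfPlane 0, ρ < s.re → LSeriesHasSum b s (F s)) (N : ℕ) (a : ℕ → ℂ) :
    ∑ n ∈ Finset.Icc 1 N, ‖(b ⍟ a) n‖ ^ 2 ≤ K ^ 2 * ∑ n ∈ Finset.Icc 1 N, ‖a n‖ ^ 2 := by
  have hK0 : 0 ≤ K := (norm_nonneg _).trans (hK 1 (by simp [halfPlane]))
  have key : ∀ d : ℕ → ℂ,
      ‖∑ k ∈ Finset.Icc 1 N, ∑ n ∈ Finset.Icc 1 N, starRingEnd ℂ (d k) * a n * convEntry b k n‖ ≤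
      K / 2 * ((∑ n ∈ Finset.Icc 1 N, ‖a n‖ ^ 2) + ∑ n ∈ Finset.Icc 1 N, ‖d n‖ ^ 2) := by
    intro d
    have hc : Continuous fun σ : ℝ =>
        K / 2 * ((∑ n ∈ Finset.Icc 1 N, ‖a n * Real.exp (-(σ * Real.log n))‖ ^ 2) +
          ∑ n ∈ Finset.Icc 1 N, ‖d n * Real.exp (σ * Real.log n)‖ ^ 2) := by fun_prop
    have h1 := (hc.tendsto 0).mono_left (nhdsWithin_le_nhds (s := Set.Ioi 0))
    simp only [zero_mul, neg_zero, Real.exp_zero, Complex.ofReal_one, mul_one] at h1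
    refine ge_of_tendsto h1 ?_
    filter_upwards [self_mem_nhdsWithin] with σ hσ
    exact norm_sum_convEntry_le_of_pos hF hK hb hσ N a d
  -- K may be 0, so a positive M ≥ K is used for the division and then M → K.
  have main : ∀ M : ℝ, K ≤ M → 0 < M →
      ∑ n ∈ Finset.Icc 1 N, ‖(b ⍟ a) n‖ ^ 2 ≤ M ^ 2 * ∑ n ∈ Finset.Icc 1 N, ‖a n‖ ^ 2 := by
    intro M hKM hM
    set S := ∑ n ∈ Finset.Icc 1 N, ‖(b ⍟ a) n‖ ^ 2 with hS
    -- With this test vector the bound becomes S ≤ M²A/2 + S/2, where A is the squared norm of `a`;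
    -- S/2 is absorbed on the left.
    have h1 := key fun k => (M⁻¹ : ℝ) * (b ⍟ a) k
    have h2 : ∑ k ∈ Finset.Icc 1 N, ∑ n ∈ Finset.Icc 1 N,
        starRingEnd ℂ ((M⁻¹ : ℝ) * (b ⍟ a) k) * a n * convEntry b k n = ((M⁻¹ * S : ℝ) : ℂ) := by
      rw [Complex.ofReal_mul, hS, Complex.ofReal_sum, Finset.mul_sum]
      refine Finset.sum_congr rfl fun k hk => ?_
      simp only [mul_assoc, mul_comm (a _)]
      rw [← Finset.mul_sum, ← convolution_eq_sum_convEntry b a hk, map_mul, Complex.conj_ofReal,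
        mul_assoc, Complex.ofReal_pow, ← Complex.conj_mul']
    have h3 : ∑ n ∈ Finset.Icc 1 N, ‖((M⁻¹ : ℝ) : ℂ) * (b ⍟ a) n‖ ^ 2 = M⁻¹ ^ 2 * S := by
      rw [hS, Finset.mul_sum]
      refine Finset.sum_congr rfl fun k _ => ?_
      rw [norm_mul, Complex.norm_real, mul_pow, Real.norm_eq_abs, sq_abs]
    have hS0 : 0 ≤ S := Finset.sum_nonneg fun _ _ => by positivity
    rw [h2, h3, Complex.norm_real, Real.norm_of_nonneg (by positivity)] at h1
    set A := ∑ n ∈ Finset.Icc 1 N, ‖a n‖ ^ 2 with hA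
    have hA0 : 0 ≤ A := Finset.sum_nonneg fun _ _ => by positivity
    have h4 : M⁻¹ * S ≤ M / 2 * (A + M⁻¹ ^ 2 * S) :=
      h1.trans (mul_le_mul_of_nonneg_right (by linarith) (by positivity))
    have h5 := mul_le_mul_of_nonneg_left h4 hM.le
    have e1 : M * (M⁻¹ * S) = S := by field_simp
    have e2 : M * (M / 2 * (A + M⁻¹ ^ 2 * S)) = M ^ 2 * A / 2 + S / 2 := by field_simp
    linarith
  have hc : Continuous fun M : ℝ => M ^ 2 * ∑ n ∈ Finset.Icc 1 N, ‖a n‖ ^ 2 := by fun_prop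
  refine ge_of_tendsto ((hc.tendsto K).mono_left (nhdsWithin_le_nhds (s := Set.Ioi K))) ?_
  filter_upwards [self_mem_nhdsWithin] with M hM
  exact main M (le_of_lt hM) (hK0.trans_lt hM)

/-- Dirichlet convolution by the coefficients of a function in `H^∞(Ω_0) ∩ D` is bounded on the
weighted spaces with weights `n ^ (-2 σ)`. -/
theorem sum_norm_convolution_sq_rpow_le {F : ℂ → ℂ} (hF : DifferentiableOn ℂ F (halfPlane 0))
    {K : ℝ} (hK : ∀ s ∈ halfPlane 0, ‖F s‖ ≤ K) {b : ℕ → ℂ} {ρ : ℝ}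
    (hb : ∀ s ∈ halfPlane 0, ρ < s.re → LSeriesHasSum b s (F s)) (N : ℕ) (a : ℕ → ℂ) {σ : ℝ}
    (hσ : 0 ≤ σ) :
    ∑ n ∈ Finset.Icc 1 N, ‖(b ⍟ a) n‖ ^ 2 * (n : ℝ) ^ (-2 * σ) ≤
      ∑ n ∈ Finset.Icc 1 N, K ^ 2 * ‖a n‖ ^ 2 * (n : ℝ) ^ (-2 * σ) := by
  have hmaps : ∀ s ∈ halfPlane 0, s + σ ∈ halfPlane 0 := fun s hs => by
    simp only [halfPlane, Set.mem_ofPred_eq, Complex.add_re, Complex.ofReal_re] at hs ⊢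
    linarith
  have hsq : ∀ (c : ℕ → ℂ) (n : ℕ), n ∈ Finset.Icc 1 N →
      ‖LSeries.term c σ n‖ ^ 2 = ‖c n‖ ^ 2 * (n : ℝ) ^ (-2 * σ) := by
    intro c n hn
    have hn1 := (Finset.mem_Icc.mp hn).1
    rw [LSeries.norm_term_eq, if_neg (by omega), Complex.ofReal_re, div_pow, ← Real.rpow_natCast
      ((n : ℝ) ^ σ), ← Real.rpow_mul (by positivity), neg_mul, Real.rpow_neg (by positivity),
      div_eq_mul_inv]
    push_cast
    rw [mul_comm σ]
  -- Translation by σ replaces b(n) by b(n) n^(-σ), and twisting by n^(-σ) is compatible with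
  -- convolution; the unweighted bound thus becomes the weighted one.
  have h1 := sum_norm_convolution_sq_le (F := fun s => F (s + σ)) (K := K)
    (b := LSeries.term b σ) (ρ := ρ)
    (hF.comp (by fun_prop) hmaps) (fun s hs => hK _ (hmaps s hs)) (fun s hs hρ => by
      have h2 := hb _ (hmaps s hs) (by
        simp only [Complex.add_re, Complex.ofReal_re]; linarith)
      have h3 : LSeries.term (LSeries.term b σ) s = LSeries.term b (s + σ) := by
        funext n
        rcases eq_or_ne n 0 with rfl | hn
        · simp
        · rw [LSeries.term_of_ne_zero hn, LSeries.term_of_ne_zero hn, LSeries.term_of_ne_zero hn,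
            Complex.cpow_add _ _ (by exact_mod_cast hn), div_div, mul_comm]
      rw [LSeriesHasSum, h3]
      exact h2) N (LSeries.term a σ)
  have h2 : LSeries.term b σ ⍟ LSeries.term a σ = LSeries.term (b ⍟ a) σ := by
    funext n
    rw [LSeries.term_convolution, LSeries.convolution_def]
  rw [h2, Finset.mul_sum] at h1
  simp only [mul_assoc]
  calc _ = _ := (Finset.sum_congr rfl (hsq _)).symm
    _ ≤ _ := h1
    _ = _ := Finset.sum_congr rfl fun n hn => by rw [hsq a n hn]

/-! ### Extension of uniform limits of bounded functions -/

/-- A uniformly bounded sequence of holomorphic functions on `Ω_0` that converges uniformly on some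
half-plane converges on all of `Ω_0`. -/
theorem exists_bounded_extension {G : ℕ → ℂ → ℂ} (hG : ∀ N, DifferentiableOn ℂ (G N) (halfPlane 0))
    {C : ℝ} (hC : ∀ N, ∀ s ∈ halfPlane 0, ‖G N s‖ ≤ C) {τ : ℝ} (hτ : 0 < τ) {f : ℂ → ℂ}
    (hf : TendstoUniformlyOn G f atTop {s | τ ≤ s.re}) :
    ∃ F : ℂ → ℂ, DifferentiableOn ℂ F (halfPlane 0) ∧ (∀ s ∈ halfPlane 0, ‖F s‖ ≤ C) ∧
      ∀ s, τ ≤ s.re → F s = f s := by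
  have hC0 : 0 ≤ C := (norm_nonneg _).trans (hC 0 1 (by simp [halfPlane]))
  have hcauchy : ∀ d, 0 < d → d < τ → UniformCauchySeqOn G atTop {s | d ≤ s.re} := by
    intro d hd hdτ
    -- Bounds the difference of two members of the sequence; the extra 1 makes A ≥ 1, so that
    -- A^(1-t) ≤ A for t ≥ 0.
    set A : ℝ := C + C + 1 with hA
    have hA1 : 1 ≤ A := by linarith
    set l : ℝ := d / 2 with hl
    have hlτ : l < τ := by linarith
    set t₀ : ℝ := (d - l) / (τ - l) with ht₀
    have ht₀pos : 0 < t₀ := div_pos (by linarith) (by linarith)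
    rw [Metric.uniformCauchySeqOn_iff]
    intro ε hε
    -- Three demands on the closeness η on Re s = τ: η ≤ ε settles the points right of τ, η ≤ 1
    -- makes η^t largest at the smallest interpolation parameter t₀, and the last term gives A η^t₀
    -- ≤ ε/2.
    set η : ℝ := min (min 1 ε) ((ε / (2 * A)) ^ (t₀⁻¹)) with hη
    have hη0 : 0 < η := by positivity
    have hη1 : η ≤ 1 := (min_le_left _ _).trans (min_le_left _ _)
    have hηε : η ≤ ε := (min_le_left _ _).trans (min_le_right _ _)
    have hηt : A * η ^ t₀ < ε := by
      have h1 : η ^ t₀ ≤ ε / (2 * A) := by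
        calc η ^ t₀ ≤ ((ε / (2 * A)) ^ (t₀⁻¹)) ^ t₀ :=
              Real.rpow_le_rpow hη0.le (min_le_right _ _) ht₀pos.le
          _ = _ := by
            rw [← Real.rpow_mul (by positivity), inv_mul_cancel₀ ht₀pos.ne', Real.rpow_one]
      calc A * η ^ t₀ ≤ A * (ε / (2 * A)) := by gcongr
        _ = ε / 2 := by field_simp
        _ < ε := by linarith
    obtain ⟨N₀, hN₀⟩ := (Metric.uniformCauchySeqOn_iff.mp hf.uniformCauchySeqOn) η hη0
    refine ⟨N₀, fun m hm n hn s hs => ?_⟩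
    rcases le_total τ s.re with hsτ | hsτ
    · exact (hN₀ m hm n hn s hsτ).trans_le hηε
    · rw [dist_eq_norm]
      have hmem : ∀ z : ℂ, l ≤ z.re → z ∈ halfPlane 0 := fun z hz =>
        (by positivity : 0 < l).trans_le hz
      have hbd : ∀ z : ℂ, l ≤ z.re → ‖G m z - G n z‖ ≤ A := fun z hz =>
        ((norm_sub_le _ _).trans (add_le_add (hC m z (hmem z hz)) (hC n z (hmem z hz)))).trans
          (by linarith)
      have hdiff : DifferentiableOn ℂ (fun z => G m z - G n z) (halfPlane 0) := (hG m).sub (hG n)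
      have hstrip : Complex.HadamardThreeLines.verticalClosedStrip l τ ⊆ halfPlane 0 :=
        fun z hz => hmem z hz.1
      have hs' : d ≤ s.re := hs
      have h1 := Complex.HadamardThreeLines.norm_le_interp_of_mem_verticalClosedStrip'
        (f := fun z => G m z - G n z) (z := s) (a := A) (b := η) hlτ
        ⟨by linarith, hsτ⟩
        (DifferentiableOn.diffContOnCl (hdiff.mono (by
          refine (closure_minimal ?_ ?_).trans hstrip
          · exact fun z hz => ⟨hz.1.le, hz.2.le⟩
          · exact isClosed_Icc.preimage Complex.continuous_re)))
        ⟨A, by rintro _ ⟨z, hz, rfl⟩; exact hbd z hz.1⟩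
        (fun z hz => hbd z (le_of_eq hz.symm))
        (fun z hz => by
          rw [← dist_eq_norm]
          exact (hN₀ m hm n hn z (le_of_eq hz.symm)).le)
      refine h1.trans_lt (lt_of_le_of_lt ?_ hηt)
      have ht : t₀ ≤ (s.re - l) / (τ - l) := by
        rw [ht₀]
        exact div_le_div_of_nonneg_right (by linarith) (by linarith)
      refine mul_le_mul ?_ (Real.rpow_le_rpow_of_exponent_ge hη0 hη1 ht) (by positivity)
        (by positivity)
      calc A ^ (1 - (s.re - l) / (τ - l)) ≤ A ^ (1 : ℝ) :=
            Real.rpow_le_rpow_of_exponent_le hA1 (by linarith)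
        _ = A := Real.rpow_one A
  have hlim : ∀ s ∈ halfPlane 0, ∃ z, Tendsto (fun N => G N s) atTop (𝓝 z) := by
    intro s hs
    have hs' : 0 < s.re := hs
    have hm := lt_min hs' hτ
    refine cauchySeq_tendsto_of_complete ((hcauchy (min s.re τ / 2) (by linarith) ?_).cauchySeq ?_)
    · linarith [min_le_right s.re τ]
    · change _ ≤ s.re
      linarith [min_le_left s.re τ]
  choose! F hF using hlim
  refine ⟨F, ?_, fun s hs => ?_, fun s hs => ?_⟩
  · refine TendstoLocallyUniformlyOn.differentiableOn (F := G) (φ := atTop) ?_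
      (Eventually.of_forall hG) (isOpen_lt continuous_const Complex.continuous_re)
    intro u hu s hs
    have hs' : 0 < s.re := hs
    have hm := lt_min hs' hτ
    have hd := (hcauchy (min s.re τ / 2) (by linarith)
      (by linarith [min_le_right s.re τ])).tendstoUniformlyOn_of_tendsto (f := F)
      fun x hx => hF x ((by linarith : (0 : ℝ) < min s.re τ / 2).trans_le hx)
    refine ⟨{z | min s.re τ / 2 ≤ z.re}, mem_nhdsWithin_of_mem_nhds ?_, hd u hu⟩
    refine mem_of_superset ((isOpen_lt continuous_const Complex.continuous_re).mem_nhds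
      (?_ : min s.re τ / 2 < s.re)) fun z hz => (le_of_lt hz : _ ≤ z.re)
    linarith [min_le_left s.re τ]
  · exact le_of_tendsto (hF s hs).norm (Eventually.of_forall fun N => hC N s hs)
  · exact tendsto_nhds_unique (hF s (hτ.trans_le hs)) (hf.tendsto_at hs)

/-! ### Convolution and smooth numbers -/

theorem convolution_assoc (f g h : ℕ → ℂ) : f ⍟ g ⍟ h = f ⍟ (g ⍟ h) := by
  simp only [LSeries.convolution, ArithmeticFunction.toArithmeticFunction_eq_self, mul_assoc]

theorem toArithmeticFunction_delta : toArithmeticFunction LSeries.delta = 1 := by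
  ext n
  change (if n = 0 then 0 else LSeries.delta n) = _
  rw [ArithmeticFunction.one_apply]
  by_cases h0 : n = 0
  · simp [h0]
  · rw [if_neg h0]
    rfl

theorem delta_convolution {g : ℕ → ℂ} (hg : g 0 = 0) : LSeries.delta ⍟ g = g := by
  rw [LSeries.convolution, toArithmeticFunction_delta, one_mul]
  funext n
  change (if n = 0 then 0 else g n) = g n
  split_ifs with h
  · rw [h, hg]
  · rfl

theorem convolution_delta {g : ℕ → ℂ} (hg : g 0 = 0) : g ⍟ LSeries.delta = g := by
  rw [← delta_convolution hg, LSeries.convolution, LSeries.convolution, mul_comm,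
    ArithmeticFunction.toArithmeticFunction_eq_self, toArithmeticFunction_delta, one_mul]

/-- Smooth numbers are closed under products and under divisors, so truncation to them is
multiplicative. -/
theorem indicator_smoothNumbers_convolution (N : ℕ) (f g : ℕ → ℂ) :
    N.smoothNumbers.indicator f ⍟ N.smoothNumbers.indicator g =
      N.smoothNumbers.indicator (f ⍟ g) := by
  funext n
  rw [LSeries.convolution_def]
  by_cases hn : n ∈ N.smoothNumbers
  · rw [Set.indicator_of_mem hn, LSeries.convolution_def]
    refine Finset.sum_congr rfl fun p hp => ?_
    have hp' := (Nat.mem_divisorsAntidiagonal.mp hp).1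
    rw [Set.indicator_of_mem (Nat.mem_smoothNumbers_of_dvd hn (Dvd.intro _ hp')),
      Set.indicator_of_mem (Nat.mem_smoothNumbers_of_dvd hn (Dvd.intro_left _ hp'))]
  · rw [Set.indicator_of_notMem hn]
    refine Finset.sum_eq_zero fun p hp => ?_
    have hp' := (Nat.mem_divisorsAntidiagonal.mp hp).1
    by_cases h1 : p.1 ∈ N.smoothNumbers
    · by_cases h2 : p.2 ∈ N.smoothNumbers
      · exact absurd (hp' ▸ Nat.mul_mem_smoothNumbers h1 h2) hn
      · rw [Set.indicator_of_notMem h2, mul_zero]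
    · rw [Set.indicator_of_notMem h1, zero_mul]

/-- The coefficient form of multiplication by n₀^(-s). It recovers a sequence from its action on a
single basis vector. -/
theorem convolution_single_apply_mul (g : ℕ → ℂ) {n₀ m : ℕ} (hn₀ : n₀ ≠ 0) (hm : m ≠ 0) :
    (g ⍟ Pi.single n₀ 1) (n₀ * m) = g m := by
  have hpos : 0 < n₀ * m := Nat.mul_pos (by omega) (by omega)
  rw [convolution_eq_sum_convEntry g _ (Finset.mem_Icc.mpr ⟨hpos, le_rfl⟩),
    Finset.sum_eq_single_of_mem n₀ (Finset.mem_Icc.mpr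
      ⟨by omega, Nat.le_mul_of_pos_right _ (by omega)⟩), Pi.single_eq_same, mul_one, convEntry,
    if_pos (Nat.dvd_mul_right _ _), Nat.mul_div_cancel_left _ (by omega)]
  intro n _ hn
  rw [Pi.single_eq_of_ne hn, mul_zero]

/-- Only the primes below N occur, so the sum is a finite product of convergent geometric series. -/
theorem summable_indicator_smoothNumbers_rpow (N : ℕ) {σ : ℝ} (hσ : 0 < σ) :
    Summable (N.smoothNumbers.indicator fun n => (n : ℝ) ^ (-σ)) := by
  let f : ℕ →* ℝ :=
    { toFun := fun n => (n : ℝ) ^ (-σ)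
      map_one' := by simp
      map_mul' := fun m n => by
        push_cast
        exact Real.mul_rpow (by positivity) (by positivity) }
  have h := (EulerProduct.summable_and_hasSum_smoothNumbers_prod_primesBelow_geometric (f := f)
    (fun {p} hp => by
      have hp1 : (1 : ℝ) < p := by exact_mod_cast hp.one_lt
      change ‖(p : ℝ) ^ (-σ)‖ < 1
      rw [Real.norm_of_nonneg (by positivity)]
      exact Real.rpow_lt_one_of_one_lt_of_neg hp1 (by linarith)) N).2.summable
  exact summable_subtype_iff_indicator.mp h

theorem differentiableOn_lseries {b : ℕ → ℂ} {ρ : ℝ} (h : ∀ s ∈ halfPlane ρ, LSeriesSummable b s) :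
    DifferentiableOn ℂ (LSeries b) (halfPlane ρ) := by
  refine (LSeries_differentiableOn _).mono fun z hz => ?_
  obtain ⟨x, hx1, hx2⟩ := exists_between (show ρ < z.re from hz)
  refine (h x (by simpa [halfPlane] using hx1)).abscissaOfAbsConv_le.trans_lt ?_
  rw [Complex.ofReal_re]
  exact_mod_cast hx2

/-! ### Sequences with a weighted square-summability condition -/

/-- Weighted arithmetic-geometric mean inequality, summed later in place of Cauchy-Schwarz. The free
parameter `lam` lets the two sums be balanced afterwards. -/
theorem norm_term_le_of_weight {c : ℕ → ℂ} {s : ℂ} {m : ℕ} (hm : m ≠ 0) {W κ ε lam : ℝ}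
    (hκ : 0 < κ) (hW : κ * (m : ℝ) ^ (-ε) ≤ W) (hl : 0 < lam) :
    ‖LSeries.term c s m‖ ≤ lam⁻¹ * (‖c m‖ ^ 2 * W) + lam * (κ⁻¹ * (m : ℝ) ^ (ε - 2 * s.re)) := by
  have hm' : (0 : ℝ) < m := by positivity
  set x : ℝ := (m : ℝ) ^ (-s.re) with hx
  have hx0 : 0 < x := by positivity
  have e1 : ‖LSeries.term c s m‖ = ‖c m‖ * x := by
    rw [LSeries.norm_term_eq, if_neg hm, hx, Real.rpow_neg hm'.le, div_eq_mul_inv]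
  have e2 : (m : ℝ) ^ (ε - 2 * s.re) = ((m : ℝ) ^ (-ε))⁻¹ * x ^ 2 := by
    rw [hx, ← Real.rpow_natCast ((m : ℝ) ^ (-s.re)), ← Real.rpow_mul hm'.le,
      ← Real.rpow_neg hm'.le, ← Real.rpow_add hm']
    congr 1
    push_cast
    ring
  set v : ℝ := (m : ℝ) ^ (-ε) with hv
  have hv0 : 0 < v := by positivity
  have h1 : ‖c m‖ * x ≤ lam⁻¹ * (‖c m‖ ^ 2 * (κ * v)) + lam * (κ⁻¹ * (v⁻¹ * x ^ 2)) := by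
    have h2 : lam⁻¹ * (‖c m‖ ^ 2 * (κ * v)) + lam * (κ⁻¹ * (v⁻¹ * x ^ 2)) - ‖c m‖ * x =
        (lam * κ * v)⁻¹ * ((‖c m‖ * (κ * v) - lam * x) ^ 2 + ‖c m‖ * (κ * v) * (lam * x)) := by
      field_simp
      ring
    have h3 : 0 ≤ (lam * κ * v)⁻¹ *
        ((‖c m‖ * (κ * v) - lam * x) ^ 2 + ‖c m‖ * (κ * v) * (lam * x)) := by positivity
    linarith
  rw [e1, e2]
  refine h1.trans ?_
  gcongr

/-- The weights `w n` decay more slowly than any negative power of `n`. -/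
def SlowDecay (w : ℕ → ℝ) (n₀ : ℕ) : Prop :=
  ∀ ε : ℝ, 0 < ε → ∃ κ : ℝ, 0 < κ ∧ ∀ n : ℕ, n₀ ≤ n → κ * (n : ℝ) ^ (-ε) ≤ w n

theorem SlowDecay.pos {w : ℕ → ℝ} {n₀ : ℕ} (hw : SlowDecay w n₀) (hn₀ : 1 ≤ n₀) {n : ℕ}
    (hn : n₀ ≤ n) : 0 < w n := by
  obtain ⟨κ, hκ, h⟩ := hw 1 one_pos
  have : (0 : ℝ) < n := by exact_mod_cast hn₀.trans hn
  exact lt_of_lt_of_le (by positivity) (h n hn)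

theorem SlowDecay.comp_mul {w : ℕ → ℝ} {n₀ : ℕ} (hw : SlowDecay w n₀) (hn₀ : 1 ≤ n₀) :
    SlowDecay (fun m => w (n₀ * m)) 1 := by
  intro ε hε
  obtain ⟨κ, hκ, h⟩ := hw ε hε
  refine ⟨κ * (n₀ : ℝ) ^ (-ε), by positivity, fun m hm => ?_⟩
  have h1 := h (n₀ * m) (Nat.le_mul_of_pos_right _ hm)
  rw [Nat.cast_mul, Real.mul_rpow (by positivity) (by positivity)] at h1
  rwa [mul_assoc]

/-- The series in the definition of `H_w` converge absolutely on `Ω_{1/2}`. -/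
theorem SlowDecay.lseriesSummable {w : ℕ → ℝ} {n₀ : ℕ} (hw : SlowDecay w n₀) (hn₀ : 1 ≤ n₀)
    {a : ℕ → ℂ} (ha0 : ∀ n < n₀, a n = 0) (ha : Summable fun n => ‖a n‖ ^ 2 * w n) {s : ℂ}
    (hs : 1 / 2 < s.re) : LSeriesSummable a s := by
  -- This ε makes the exponent ε - 2 Re s equal to -(Re s + 1/2), which is below -1.
  obtain ⟨κ, hκ, h⟩ := hw (s.re - 1 / 2) (by linarith)
  have h1 : Summable fun m : ℕ => (m : ℝ) ^ (s.re - 1 / 2 - 2 * s.re) :=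
    Real.summable_nat_rpow.mpr (by linarith)
  refine Summable.of_norm_bounded ((ha.mul_left 1⁻¹).add ((h1.mul_left κ⁻¹).mul_left 1)) fun m => ?_
  by_cases hm : m < n₀
  · have : LSeries.term a s m = 0 := by simp [LSeries.term_def, ha0 m hm]
    rw [this, norm_zero, ha0 m hm]
    have hp : (0 : ℝ) ≤ (m : ℝ) ^ (s.re - 1 / 2 - 2 * s.re) := by positivity
    simpa using mul_nonneg (inv_nonneg.mpr hκ.le) hp
  · exact norm_term_le_of_weight (by omega) hκ (h m (by omega)) one_pos

/-- On smooth numbers, series with square-summable coefficients converge absolutely on `Ω_0`. -/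
theorem SlowDecay.lseries_indicator_smoothNumbers {w : ℕ → ℝ} (hw : SlowDecay w 1) (N : ℕ) {s : ℂ}
    (hs : 0 < s.re) : ∃ A : ℝ, ∀ c : ℕ → ℂ, c 0 = 0 → (Summable fun n => ‖c n‖ ^ 2 * w n) →
      LSeriesSummable (N.smoothNumbers.indicator c) s ∧ ∀ lam : ℝ, 0 < lam →
        ‖LSeries (N.smoothNumbers.indicator c) s‖ ≤
          lam⁻¹ * (∑' n, ‖c n‖ ^ 2 * w n) + lam * A := by
  -- With ε = Re s the exponent ε - 2 Re s is -Re s, summable over smooth numbers. The resulting A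
  -- depends on s and N but not on `c`.
  obtain ⟨κ, hκ, h⟩ := hw s.re hs
  have h1 := (summable_indicator_smoothNumbers_rpow N hs).mul_left κ⁻¹
  refine ⟨∑' m, κ⁻¹ * N.smoothNumbers.indicator (fun n => (n : ℝ) ^ (-s.re)) m,
    fun c hc0 hc => ?_⟩
  have hle : ∀ lam : ℝ, 0 < lam → ∀ m, ‖LSeries.term (N.smoothNumbers.indicator c) s m‖ ≤
      lam⁻¹ * (‖c m‖ ^ 2 * w m) +
        lam * (κ⁻¹ * N.smoothNumbers.indicator (fun n => (n : ℝ) ^ (-s.re)) m) := by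
    intro lam hl m
    by_cases hm : m ∈ N.smoothNumbers
    · have hm0 := Nat.ne_zero_of_mem_smoothNumbers hm
      have h2 := norm_term_le_of_weight (c := N.smoothNumbers.indicator c) (s := s) hm0 hκ
        (h m (by omega)) hl
      rw [Set.indicator_of_mem hm] at h2 ⊢
      rwa [show s.re - 2 * s.re = -s.re by ring] at h2
    · have : LSeries.term (N.smoothNumbers.indicator c) s m = 0 := by
        simp [LSeries.term_def, Set.indicator_of_notMem hm]
      rw [this, norm_zero, Set.indicator_of_notMem hm, mul_zero, mul_zero, add_zero]
      rcases eq_or_ne m 0 with rfl | hm0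
      · simp [hc0]
      · have := hw.pos le_rfl (n := m) (by omega)
        positivity
  have hsum : ∀ lam : ℝ, 0 < lam →
      Summable fun m => ‖LSeries.term (N.smoothNumbers.indicator c) s m‖ :=
    fun lam hl => Summable.of_nonneg_of_le (fun _ => norm_nonneg _) (hle lam hl)
      ((hc.mul_left _).add (h1.mul_left _))
  refine ⟨(hsum 1 one_pos).of_norm, fun lam hl => ?_⟩
  refine (norm_tsum_le_tsum_norm (hsum lam hl)).trans ?_
  rw [← tsum_mul_left, ← tsum_mul_left, ← (hc.mul_left _).tsum_add (h1.mul_left _)]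
  exact (hsum lam hl).tsum_le_tsum (hle lam hl) ((hc.mul_left _).add (h1.mul_left _))

/-! ### Convolution powers and the bound on Ω_0. -/

/-- Convolution by `b` is bounded by `C` on the sequence space of `H_w`. -/
def IsConvBound (w : ℕ → ℝ) (n₀ : ℕ) (b : ℕ → ℂ) (C : ℝ) : Prop :=
  ∀ a : ℕ → ℂ, (∀ n < n₀, a n = 0) → (Summable fun n => ‖a n‖ ^ 2 * w n) →
    (Summable fun n => ‖(b ⍟ a) n‖ ^ 2 * w n) ∧
      ∑' n, ‖(b ⍟ a) n‖ ^ 2 * w n ≤ C ^ 2 * ∑' n, ‖a n‖ ^ 2 * w n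

theorem convolution_eq_zero_of_lt (b : ℕ → ℂ) {a : ℕ → ℂ} {n₀ : ℕ} (ha0 : ∀ n < n₀, a n = 0)
    {n : ℕ} (hn : n < n₀) : (b ⍟ a) n = 0 := by
  rw [LSeries.convolution_def]
  refine Finset.sum_eq_zero fun p hp => ?_
  rw [ha0, mul_zero]
  exact (Nat.divisor_le (Nat.snd_mem_divisors_of_mem_antidiagonal hp)).trans_lt hn

/-- The convolution powers of `b`. -/
noncomputable def convPow (b : ℕ → ℂ) : ℕ → ℕ → ℂ
  | 0 => LSeries.delta
  | j + 1 => b ⍟ convPow b j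

theorem convPow_apply_zero (b : ℕ → ℂ) (j : ℕ) : convPow b j 0 = 0 := by
  cases j with
  | zero => simp [convPow, LSeries.delta]
  | succ j => exact LSeries.convolution_map_zero _ _

theorem IsConvBound.convPow_le {w : ℕ → ℝ} {n₀ : ℕ} {b : ℕ → ℂ} {C : ℝ} (hb : IsConvBound w n₀ b C)
    (hw : SlowDecay w n₀) (hn₀ : 1 ≤ n₀) (j : ℕ) :
    (Summable fun m => ‖convPow b j m‖ ^ 2 * w (n₀ * m)) ∧
      ∑' m, ‖convPow b j m‖ ^ 2 * w (n₀ * m) ≤ (C ^ j) ^ 2 * w n₀ := by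
  -- For n₀ > 1 the unit δ is not in the sequence space, so the operator is iterated on the basis
  -- vector at n₀; this shifts the index m to n₀ m and explains the weight `w (n₀ * m)`.
  obtain ⟨a, ha⟩ : ∃ a : ℕ → ℕ → ℂ, ∀ j, a j = convPow b j ⍟ Pi.single n₀ 1 :=
    ⟨_, fun _ => rfl⟩
  have hsingle : ∀ n < n₀, (Pi.single n₀ 1 : ℕ → ℂ) n = 0 := fun n hn =>
    Pi.single_eq_of_ne hn.ne _
  have ha0 : ∀ j, ∀ n < n₀, a j n = 0 := fun j n hn => by
    rw [ha]
    exact convolution_eq_zero_of_lt _ hsingle hn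
  have hδ : a 0 = Pi.single n₀ 1 := by
    rw [ha]
    exact delta_convolution (hsingle 0 (by omega))
  have key : ∀ j, (Summable fun n => ‖a j n‖ ^ 2 * w n) ∧
      ∑' n, ‖a j n‖ ^ 2 * w n ≤ (C ^ j) ^ 2 * w n₀ := by
    intro j
    induction j with
    | zero =>
      have h1 : ∀ n, n ≠ n₀ → ‖a 0 n‖ ^ 2 * w n = 0 := fun n hn => by
        rw [hδ, Pi.single_eq_of_ne hn]; simp
      refine ⟨summable_of_ne_finset_zero (s := {n₀}) fun n hn => h1 n (by simpa using hn), ?_⟩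
      rw [tsum_eq_single n₀ h1, hδ]
      simp
    | succ j ih =>
      have h1 : a (j + 1) = b ⍟ a j := by
        rw [ha, ha]
        exact convolution_assoc _ _ _
      obtain ⟨h2, h3⟩ := hb (a j) (ha0 j) ih.1
      rw [h1]
      refine ⟨h2, h3.trans ?_⟩
      calc C ^ 2 * _ ≤ C ^ 2 * ((C ^ j) ^ 2 * w n₀) := by gcongr; exact ih.2
        _ = _ := by ring
  have hinj : Function.Injective fun m : ℕ => n₀ * m := fun x y hxy =>
    Nat.eq_of_mul_eq_mul_left hn₀ hxy
  have heq : (fun m => ‖convPow b j m‖ ^ 2 * w (n₀ * m)) =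
      (fun n => ‖a j n‖ ^ 2 * w n) ∘ fun m => n₀ * m := by
    funext m
    simp only [Function.comp]
    rcases eq_or_ne m 0 with rfl | hm
    · simp only [convPow_apply_zero, mul_zero, ha, LSeries.convolution_map_zero, norm_zero,
        ne_eq, OfNat.ofNat_ne_zero, not_false_eq_true, zero_pow, zero_mul]
    · rw [ha, convolution_single_apply_mul _ (by omega) hm]
  have hnn : ∀ n, 0 ≤ ‖a j n‖ ^ 2 * w n := by
    intro n
    by_cases hn : n < n₀
    · rw [ha0 j n hn]; simp
    · have := hw.pos hn₀ (n := n) (by omega)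
      positivity
  rw [heq]
  refine ⟨(key j).1.comp_injective hinj, ?_⟩
  exact (tsum_comp_le_tsum_of_inj (key j).1 hnn hinj).trans (key j).2

/-- The spectral radius argument: a constant factor is invisible to j-th roots. -/
theorem le_of_forall_pow_le {r C B : ℝ} (hC : 0 < C) (h : ∀ j : ℕ, r ^ j ≤ C ^ j * B) : r ≤ C := by
  by_contra! hr
  have h1 : 1 < r / C := (one_lt_div hC).mpr hr
  obtain ⟨j, hj⟩ := ((tendsto_pow_atTop_atTop_of_one_lt h1).eventually_gt_atTop B).exists
  rw [div_pow, lt_div_iff₀ (by positivity)] at hj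
  linarith [h j]

/-- A sequence that defines a bounded convolution operator on the sequence space of `H_w` is the
coefficient sequence of a bounded holomorphic function on `Ω_0`. -/
theorem IsConvBound.exists_extension {w : ℕ → ℝ} {n₀ : ℕ} {b : ℕ → ℂ} {C : ℝ}
    (hb : IsConvBound w n₀ b C) (hw : SlowDecay w n₀) (hn₀ : 1 ≤ n₀) (hC : 0 < C) :
    ∃ F : ℂ → ℂ, DifferentiableOn ℂ F (halfPlane 0) ∧ (∀ s ∈ halfPlane 0, ‖F s‖ ≤ C) ∧
      ∀ s, 1 ≤ s.re → LSeriesHasSum b s (F s) := by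
  -- Neither the L-series nor convolution sees index 0, whereas b ⍟ δ = b holds only when b 0 = 0.
  wlog hb0 : b 0 = 0 generalizing b
  · have hcongr : ∀ {n}, n ≠ 0 → Function.update b 0 0 n = b n := fun {n} hn =>
      Function.update_of_ne hn _ _
    obtain ⟨F, h1, h2, h3⟩ := this (b := Function.update b 0 0) (fun a ha0 ha => by
      rw [LSeries.convolution_congr (g' := a) hcongr fun _ => rfl]
      exact hb a ha0 ha) (by simp)
    exact ⟨F, h1, h2, fun s hs => (LSeriesHasSum_congr s _ hcongr).mp (h3 s hs)⟩
  have hw1 := hw.comp_mul hn₀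
  have hpow1 : convPow b 1 = b := convolution_delta hb0
  have hbs : Summable fun m => ‖b m‖ ^ 2 * w (n₀ * m) := by
    have := (hb.convPow_le hw hn₀ 1).1
    rwa [hpow1] at this
  have hsummable : ∀ N : ℕ, ∀ s ∈ halfPlane 0, LSeriesSummable (N.smoothNumbers.indicator b) s := by
    intro N s hs
    obtain ⟨A, hA⟩ := hw1.lseries_indicator_smoothNumbers N (s := s) hs
    exact (hA b hb0 hbs).1
  have hbound : ∀ N : ℕ, ∀ s ∈ halfPlane 0, ‖LSeries (N.smoothNumbers.indicator b) s‖ ≤ C := by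
    intro N s hs
    obtain ⟨A, hA⟩ := hw1.lseries_indicator_smoothNumbers N (s := s) hs
    have hN : ∀ j, LSeriesHasSum (N.smoothNumbers.indicator (convPow b j)) s
        (LSeries (N.smoothNumbers.indicator b) s ^ j) := by
      intro j
      induction j with
      | zero =>
        have h1 : N.smoothNumbers.indicator (convPow b 0) = LSeries.delta := by
          refine Set.indicator_eq_self.mpr fun n hn => ?_
          have : n = 1 := by
            by_contra h
            exact hn (if_neg h)
          exact this ▸ Nat.mem_smoothNumbers.mpr (by simp)
        have h2 : LSeries.term LSeries.delta s = fun n => if n = 1 then 1 else 0 :=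
          funext fun n => LSeries.term_delta s n
        rw [h1, LSeriesHasSum, h2, pow_zero]
        exact hasSum_ite_eq 1 1
      | succ j ih =>
        change LSeriesHasSum (N.smoothNumbers.indicator (b ⍟ convPow b j)) _ _
        rw [← indicator_smoothNumbers_convolution, pow_succ']
        exact (hsummable N s hs).LSeriesHasSum.convolution ih
    refine le_of_forall_pow_le hC (B := w n₀ + A) fun j => ?_
    rw [← norm_pow, ← (hN j).LSeries_eq]
    obtain ⟨h1, h2⟩ := hb.convPow_le hw hn₀ j
    -- The choice `lam` = C^j balances the squared norm C^(2j) w(n₀) against A, so that both terms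
    -- grow like C^j.
    refine ((hA _ (convPow_apply_zero b j) h1).2 (C ^ j) (by positivity)).trans ?_
    calc _ ≤ (C ^ j)⁻¹ * ((C ^ j) ^ 2 * w n₀) + C ^ j * A := by gcongr
      _ = _ := by field_simp
  have hb1 : LSeriesSummable b ((1 : ℝ) : ℂ) := hw1.lseriesSummable le_rfl
    (fun n hn => by rw [Nat.lt_one_iff.mp hn, hb0]) hbs (by norm_num)
  have hb1' : ∀ s : ℂ, 1 ≤ s.re → LSeriesSummable b s := fun s hs =>
    LSeriesSummable.of_re_le_re (by simpa using hs) hb1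
  -- On Re s ≥ 1 each term is dominated by its modulus at s = 1, and every n ≥ 1 is N-smooth once N
  -- > n.
  have hunif : TendstoUniformlyOn (fun N : ℕ => LSeries (N.smoothNumbers.indicator b))
      (LSeries b) atTop {s | 1 ≤ s.re} := by
    have h1 : Tendsto (fun N : ℕ => ∑' n, ‖LSeries.term (b - N.smoothNumbers.indicator b)
        ((1 : ℝ) : ℂ) n‖) atTop (𝓝 (∑' _ : ℕ, 0)) := by
      refine tendsto_tsum_of_dominated_convergence hb1.norm (fun n => ?_)
        (Eventually.of_forall fun N n => ?_)
      · refine tendsto_const_nhds.congr' ?_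
        filter_upwards [eventually_gt_atTop n] with N hN
        rcases eq_or_ne n 0 with rfl | hn
        · simp
        · simp [LSeries.term_def, Set.indicator_of_mem
            (Nat.mem_smoothNumbers_of_lt (by omega : 0 < n) hN)]
      · rw [norm_norm]
        refine LSeries.norm_term_le _ ?_
        by_cases hn : n ∈ N.smoothNumbers <;> simp [hn]
    rw [tsum_zero] at h1
    rw [Metric.tendstoUniformlyOn_iff]
    intro ε hε
    filter_upwards [h1.eventually_lt_const hε] with N hN s hs
    refine lt_of_le_of_lt ?_ hN
    have hs0 : s ∈ halfPlane 0 := zero_lt_one.trans_le hs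
    rw [dist_eq_norm, ← LSeries_sub (hb1' s hs) (hsummable N s hs0)]
    have hsub : LSeriesSummable (b - N.smoothNumbers.indicator b) ((1 : ℝ) : ℂ) :=
      hb1.sub (hsummable N _ (by simp [halfPlane]))
    have hle : ∀ n, ‖LSeries.term (b - N.smoothNumbers.indicator b) s n‖ ≤
        ‖LSeries.term (b - N.smoothNumbers.indicator b) ((1 : ℝ) : ℂ) n‖ :=
      LSeries.norm_term_le_of_re_le_re _ (by simpa using hs)
    have hs1 : Summable fun n => ‖LSeries.term (b - N.smoothNumbers.indicator b) s n‖ :=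
      Summable.of_nonneg_of_le (fun _ => norm_nonneg _) hle hsub.norm
    exact (norm_tsum_le_tsum_norm hs1).trans (hs1.tsum_le_tsum hle hsub.norm)
  have hdiff : ∀ N : ℕ, DifferentiableOn ℂ (LSeries (N.smoothNumbers.indicator b)) (halfPlane 0) :=
    fun N => differentiableOn_lseries (hsummable N)
  obtain ⟨F, hFd, hFb, hFe⟩ := exists_bounded_extension hdiff hbound one_pos hunif
  refine ⟨F, hFd, hFb, fun s hs => ?_⟩
  rw [hFe s hs]
  exact (hb1' s hs).LSeriesHasSum

/-! ### Boundedness of convolution operators -/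

theorem convolution_add (b x y : ℕ → ℂ) : b ⍟ (x + y) = b ⍟ x + b ⍟ y := by
  funext n
  simp only [LSeries.convolution_def, Pi.add_apply, mul_add, Finset.sum_add_distrib]

theorem convolution_smul (b : ℕ → ℂ) (c : ℂ) (x : ℕ → ℂ) : b ⍟ (c • x) = c • (b ⍟ x) := by
  funext n
  simp only [LSeries.convolution_def, Pi.smul_apply, smul_eq_mul, Finset.mul_sum, mul_left_comm]

/-- A convolution operator on the sequence space of `H_w` is bounded (closed graph theorem). -/
theorem exists_isConvBound {w : ℕ → ℝ} {n₀ : ℕ} (hw : SlowDecay w n₀) (hn₀ : 1 ≤ n₀) {b : ℕ → ℂ}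
    (hb : ∀ a : ℕ → ℂ, (∀ n < n₀, a n = 0) → (Summable fun n => ‖a n‖ ^ 2 * w n) →
      Summable fun n => ‖(b ⍟ a) n‖ ^ 2 * w n) : ∃ C, 0 ≤ C ∧ IsConvBound w n₀ b C := by
  set r : ℕ → ℝ := fun n => Real.sqrt (w n) with hr
  have hr0 : ∀ n, n₀ ≤ n → r n ≠ 0 := fun n hn => (Real.sqrt_pos.mpr (hw.pos hn₀ hn)).ne'
  have hr2 : ∀ n, n₀ ≤ n → r n ^ 2 = w n := fun n hn => Real.sq_sqrt (hw.pos hn₀ hn).le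
  have hsq : ∀ a : ℕ → ℂ, (∀ n < n₀, a n = 0) → ∀ n, ‖(r n : ℂ) * a n‖ ^ (2 : ENNReal).toReal =
      ‖a n‖ ^ 2 * w n := by
    intro a ha n
    rw [ENNReal.toReal_ofNat, Real.rpow_ofNat, norm_mul, mul_pow, Complex.norm_real,
      Real.norm_eq_abs, sq_abs]
    by_cases hn : n < n₀
    · simp [ha n hn]
    · rw [hr2 n (by omega), mul_comm]
  -- Decodes an ℓ² vector into coefficients, undoing multiplication by √w. Indices below n₀ are
  -- discarded, since nothing is known about w there.
  set dec : (ℕ → ℂ) → ℕ → ℂ := fun x n => if n < n₀ then 0 else (r n : ℂ)⁻¹ * x n with hdec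
  have hdec0 : ∀ x, ∀ n < n₀, dec x n = 0 := fun x n hn => if_pos hn
  have hdecadd : ∀ x y, dec (x + y) = dec x + dec y := by
    intro x y
    funext n
    simp only [hdec, Pi.add_apply]
    split_ifs <;> ring
  have hdecsmul : ∀ (c : ℂ) x, dec (c • x) = c • dec x := by
    intro c x
    funext n
    simp only [hdec, Pi.smul_apply, smul_eq_mul]
    split_ifs <;> ring
  have hdecS : ∀ x : lp (fun _ : ℕ => ℂ) 2, Summable fun n => ‖dec x n‖ ^ 2 * w n := by
    intro x
    have hx := (memℓp_gen_iff (p := 2) (by simp)).mp (lp.memℓp x)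
    refine Summable.of_nonneg_of_le (fun n => ?_) (fun n => ?_) hx
    · by_cases hn : n < n₀
      · simp [hdec0 _ n hn]
      · have := hw.pos hn₀ (n := n) (by omega)
        positivity
    · by_cases hn : n < n₀
      · simp [hdec0 _ n hn]
      · rw [← hsq _ (hdec0 x)]
        simp only [hdec, if_neg hn]
        rw [mul_inv_cancel_left₀ (by exact_mod_cast hr0 n (by omega))]
  have hmem : ∀ x : lp (fun _ : ℕ => ℂ) 2, Memℓp (fun n => (r n : ℂ) * (b ⍟ dec x) n) 2 := by
    intro x
    refine (memℓp_gen_iff (p := 2) (by simp)).mpr ?_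
    simp only [hsq _ fun n hn => convolution_eq_zero_of_lt b (hdec0 x) hn]
    exact hb _ (hdec0 x) (hdecS x)
  let T : lp (fun _ : ℕ => ℂ) 2 →ₗ[ℂ] lp (fun _ : ℕ => ℂ) 2 :=
    { toFun := fun x => ⟨_, hmem x⟩
      map_add' := fun x y => by
        ext n
        change (r n : ℂ) * (b ⍟ dec (⇑x + ⇑y)) n = _
        rw [hdecadd, convolution_add, Pi.add_apply, mul_add]
        rfl
      map_smul' := fun c x => by
        ext n
        change (r n : ℂ) * (b ⍟ dec (c • ⇑x)) n = c * _
        rw [hdecsmul, convolution_smul, Pi.smul_apply, smul_eq_mul, mul_left_comm] }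
  have hT : ∀ x n, T x n = (r n : ℂ) * (b ⍟ dec x) n := fun _ _ => rfl
  have hcoord : ∀ {u : ℕ → lp (fun _ : ℕ => ℂ) 2} {x}, Tendsto u atTop (𝓝 x) → ∀ n,
      Tendsto (fun k => u k n) atTop (𝓝 (x n)) := fun hu n =>
    ((lp.evalCLM ℂ (fun _ : ℕ => ℂ) 2 n).continuous.tendsto _).comp hu
  -- Each coordinate of the image is a finite combination of coordinates of the argument, so the
  -- graph is closed.
  have hcont : Continuous T := by
    refine T.continuous_of_seq_closed_graph fun u x y hu hTu => ?_
    ext n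
    refine tendsto_nhds_unique (hcoord hTu n) ?_
    simp only [Function.comp, hT, LSeries.convolution_def]
    refine (tendsto_finsetSum _ fun p _ => Tendsto.const_mul _ ?_).const_mul _
    simp only [hdec]
    split_ifs
    · exact tendsto_const_nhds
    · exact (hcoord hu _).const_mul _
  let T' : lp (fun _ : ℕ => ℂ) 2 →L[ℂ] lp (fun _ : ℕ => ℂ) 2 := ⟨T, hcont⟩
  refine ⟨‖T'‖, norm_nonneg _, fun a ha0 ha => ⟨hb a ha0 ha, ?_⟩⟩
  have hxm : Memℓp (fun n => (r n : ℂ) * a n) 2 := by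
    refine (memℓp_gen_iff (p := 2) (by simp)).mpr ?_
    simpa only [hsq a ha0] using ha
  let x : lp (fun _ : ℕ => ℂ) 2 := ⟨_, hxm⟩
  have hxn : ∀ n, x n = (r n : ℂ) * a n := fun _ => rfl
  have hdx : dec x = a := by
    funext n
    simp only [hdec, hxn]
    split_ifs with hn
    · exact (ha0 n hn).symm
    · exact inv_mul_cancel_left₀ (by exact_mod_cast hr0 n (by omega)) _
  have h1 := lp.norm_rpow_eq_tsum (p := 2) (by simp) x
  have h2 := lp.norm_rpow_eq_tsum (p := 2) (by simp) (T x)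
  simp only [hxn, hsq a ha0] at h1
  simp only [hT, hdx, hsq _ fun n hn => convolution_eq_zero_of_lt b ha0 hn] at h2
  rw [← h1, ← h2, ENNReal.toReal_ofNat, Real.rpow_ofNat, Real.rpow_ofNat, ← mul_pow]
  exact pow_le_pow_left₀ (norm_nonneg _) (T'.le_opNorm x) 2

/-! ### Elements of `H_w` and their coefficients -/

theorem eq_of_lseriesHasSum {a c : ℕ → ℂ} {f : halfPlane (1 / 2) → ℂ}
    (ha : ∀ s : halfPlane (1 / 2), LSeriesHasSum a s (f s))
    (hc : ∀ s : halfPlane (1 / 2), LSeriesHasSum c s (f s)) {n : ℕ} (hn : n ≠ 0) : a n = c n := by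
  have key : ∀ {c : ℕ → ℂ}, (∀ s : halfPlane (1 / 2), LSeriesHasSum c s (f s)) →
      LSeries.abscissaOfAbsConv c < ⊤ := fun {c} hc =>
    (hc ⟨1, by norm_num [halfPlane]⟩).LSeriesSummable.abscissaOfAbsConv_le.trans_lt
      (EReal.coe_lt_top _)
  refine LSeries.eq_of_LSeries_eventually_eq (key ha) (key hc) ?_ hn
  filter_upwards [eventually_gt_atTop (1 / 2 : ℝ)] with x hx
  have hx' : (x : ℂ) ∈ halfPlane (1 / 2) := by simpa [halfPlane] using! hx
  exact (ha ⟨x, hx'⟩).LSeries_eq.trans (hc ⟨x, hx'⟩).LSeries_eq.symm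

theorem HSpace.coeff_spec {w : ℕ → ℝ} {n₀ : ℕ} (f : HSpace w n₀) :
    (∀ n < n₀, HSpace.coeff f n = 0) ∧ (Summable fun n => ‖HSpace.coeff f n‖ ^ 2 * w n) ∧
      ∀ s : halfPlane (1 / 2), LSeriesHasSum (HSpace.coeff f) s (f.1 s) :=
  Classical.choose_spec f.2

theorem SlowDecay.exists_coeff_eq {w : ℕ → ℝ} {n₀ : ℕ} (hw : SlowDecay w n₀) (hn₀ : 1 ≤ n₀)
    {a : ℕ → ℂ} (ha0 : ∀ n < n₀, a n = 0) (ha : Summable fun n => ‖a n‖ ^ 2 * w n) :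
    ∃ f : HSpace w n₀, HSpace.coeff f = a := by
  have h : ∀ s : halfPlane (1 / 2), LSeriesHasSum a s (LSeries a s) := fun s =>
    (hw.lseriesSummable hn₀ ha0 ha s.2).LSeriesHasSum
  exact ⟨⟨fun s => LSeries a s, a, ha0, ha, h⟩, HSpace.coeff_eq hn₀ _ ha0 h⟩

theorem SlowDecay.exists_coeff_eq_single {w : ℕ → ℝ} {n₀ : ℕ} (hw : SlowDecay w n₀) (hn₀ : 1 ≤ n₀)
    {k : ℕ} (hk : n₀ ≤ k) : ∃ f : HSpace w n₀, HSpace.coeff f = Pi.single k 1 := by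
  refine hw.exists_coeff_eq hn₀ (fun n hn => Pi.single_eq_of_ne (by omega) _) ?_
  refine summable_of_ne_finset_zero (s := {k}) fun n hn => ?_
  rw [Pi.single_eq_of_ne (by simpa using hn)]
  simp

theorem lseriesHasSum_single {k : ℕ} (hk : k ≠ 0) (s : ℂ) :
    LSeriesHasSum (Pi.single k 1) s ((k : ℂ) ^ s)⁻¹ := by
  rw [LSeriesHasSum]
  have h := hasSum_single (f := LSeries.term (Pi.single k 1) s) k fun n hn => by
    simp [LSeries.term_def, Pi.single_eq_of_ne hn]
  rwa [LSeries.term_of_ne_zero hk, Pi.single_eq_same, one_div] at h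

theorem convolution_single_apply_of_not_dvd (g : ℕ → ℂ) {k n : ℕ} (h : ¬ k ∣ n) :
    (g ⍟ Pi.single k 1) n = 0 := by
  rw [LSeries.convolution_def]
  refine Finset.sum_eq_zero fun p hp => ?_
  rw [Pi.single_eq_of_ne, mul_zero]
  rintro rfl
  exact h (Dvd.intro_left _ (Nat.mem_divisorsAntidiagonal.mp hp).1)

/-! ### Multipliers are Dirichlet series -/

/-- Every multiplier of `H_w` is given by an absolutely convergent Dirichlet series on `Ω_{1/2}`. -/
theorem exists_lseriesHasSum_of_multiplier {w : ℕ → ℝ} {n₀ : ℕ} (hw : SlowDecay w n₀)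
    (hn₀ : 1 ≤ n₀) (φ : multiplierAlgebra w n₀) :
    ∃ b : ℕ → ℂ, ∀ s : halfPlane (1 / 2), LSeriesHasSum b s (φ.1 s) := by
  have hc : ∀ k, n₀ ≤ k → ∃ c : ℕ → ℂ, c 0 = 0 ∧ ∀ s : halfPlane (1 / 2),
      LSeriesHasSum c s (φ.1 s * ((k : ℂ) ^ s.1)⁻¹) := by
    intro k hk
    obtain ⟨f, hf⟩ := hw.exists_coeff_eq_single hn₀ hk
    have h1 := HSpace.coeff_spec (mulOp φ f)
    refine ⟨_, h1.1 0 (by omega), fun s => ?_⟩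
    have h2 := (HSpace.coeff_spec f).2.2 s
    rw [hf] at h2
    rw [← HasSum.unique h2 (lseriesHasSum_single (by omega) s.1)]
    exact h1.2.2 s
  obtain ⟨c, hc0, hcs⟩ := hc n₀ le_rfl
  obtain ⟨c', -, hcs'⟩ := hc (n₀ + 1) (by omega)
  -- The product φ(s) n₀^(-s) (n₀+1)^(-s) is expanded in two ways.
  have heq : ∀ {n}, n ≠ 0 → (c ⍟ Pi.single (n₀ + 1) 1) n = (c' ⍟ Pi.single n₀ 1) n := fun {n} hn =>
    eq_of_lseriesHasSum (f := fun s => φ.1 s * ((n₀ : ℂ) ^ s.1)⁻¹ * (((n₀ + 1 : ℕ) : ℂ) ^ s.1)⁻¹)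
      (fun s => (hcs s).convolution (lseriesHasSum_single (by omega) s.1))
      (fun s => by
        rw [mul_right_comm]
        exact (hcs' s).convolution (lseriesHasSum_single (by omega) s.1)) hn
  -- The value c k sits at index (n₀+1)k, where the other expansion vanishes unless n₀ divides it.
  -- Since n₀ and n₀+1 are coprime, φ(s) n₀^(-s) only involves multiples of n₀ and can be divided by
  -- n₀^(-s).
  have hdvd : ∀ k, ¬ n₀ ∣ k → c k = 0 := by
    intro k hk
    have hk0 : k ≠ 0 := by
      rintro rfl
      exact hk (dvd_zero _)
    rw [← convolution_single_apply_mul c (by omega : n₀ + 1 ≠ 0) hk0,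
      heq (Nat.mul_ne_zero (by omega) hk0), convolution_single_apply_of_not_dvd]
    intro h
    exact hk (Nat.Coprime.dvd_of_dvd_mul_left (by simp) h)
  refine ⟨fun m => c (n₀ * m), fun s => ?_⟩
  have hn : (n₀ : ℂ) ^ s.1 ≠ 0 := by
    rw [Ne, Complex.cpow_eq_zero_iff]
    exact fun h => (by omega : n₀ ≠ 0) (by exact_mod_cast h.1)
  have hinj : Function.Injective fun m : ℕ => n₀ * m := fun x y hxy =>
    Nat.eq_of_mul_eq_mul_left hn₀ hxy
  have h1 : HasSum (LSeries.term c s ∘ fun m => n₀ * m) (φ.1 s * ((n₀ : ℂ) ^ s.1)⁻¹) := by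
    refine (hinj.hasSum_iff fun n hn => ?_).mpr (hcs s)
    rw [LSeries.term_def, hdvd n fun ⟨m, hm⟩ => hn ⟨m, hm.symm⟩]
    simp
  refine (hasSum_mul_right_iff (inv_ne_zero hn)).mp (h1.congr_fun fun m => ?_)
  rcases eq_or_ne m 0 with rfl | hm
  · simp
  · rw [Function.comp, LSeries.term_of_ne_zero hm,
      LSeries.term_of_ne_zero (Nat.mul_ne_zero (by omega) hm), Nat.cast_mul,
      Complex.natCast_mul_natCast_cpow]
    ring

/-- A multiplier acts on coefficients by Dirichlet convolution. -/
theorem coeff_mulOp {w : ℕ → ℝ} {n₀ : ℕ} (hn₀ : 1 ≤ n₀) {φ : multiplierAlgebra w n₀} {b : ℕ → ℂ}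
    (hb : ∀ s : halfPlane (1 / 2), LSeriesHasSum b s (φ.1 s)) (f : HSpace w n₀) :
    HSpace.coeff (mulOp φ f) = b ⍟ HSpace.coeff f := by
  obtain ⟨h0, -, hs⟩ := HSpace.coeff_spec f
  exact HSpace.coeff_eq hn₀ _ (fun n hn => convolution_eq_zero_of_lt b h0 hn)
    fun s => (hb s).convolution (hs s)

theorem isMulBound_iff {w : ℕ → ℝ} {n₀ : ℕ} (hw : SlowDecay w n₀) (hn₀ : 1 ≤ n₀)
    {φ : multiplierAlgebra w n₀} {b : ℕ → ℂ}
    (hb : ∀ s : halfPlane (1 / 2), LSeriesHasSum b s (φ.1 s)) {C : ℝ} :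
    IsMulBound φ C ↔ 0 ≤ C ∧ IsConvBound w n₀ b C := by
  have hnn : ∀ a : ℕ → ℂ, (∀ n < n₀, a n = 0) → 0 ≤ ∑' n, ‖a n‖ ^ 2 * w n := by
    refine fun a ha0 => tsum_nonneg fun n => ?_
    by_cases hn : n < n₀
    · simp [ha0 n hn]
    · have := hw.pos hn₀ (n := n) (by omega)
      positivity
  refine and_congr_right fun hC => ?_
  have key : ∀ f : HSpace w n₀, HSpace.hnorm (mulOp φ f) ≤ C * HSpace.hnorm f ↔
      ∑' n, ‖(b ⍟ HSpace.coeff f) n‖ ^ 2 * w n ≤ C ^ 2 * ∑' n, ‖HSpace.coeff f n‖ ^ 2 * w n := by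
    intro f
    have h0 := hnn _ (HSpace.coeff_spec f).1
    rw [HSpace.hnorm, HSpace.hnorm, coeff_mulOp hn₀ hb, Real.sqrt_le_left (by positivity), mul_pow,
      Real.sq_sqrt h0]
  simp only [key]
  constructor
  · intro h a ha0 ha
    obtain ⟨f, hf⟩ := hw.exists_coeff_eq hn₀ ha0 ha
    have h1 := (HSpace.coeff_spec (mulOp φ f)).2.1
    rw [coeff_mulOp hn₀ hb, hf] at h1
    exact ⟨h1, hf ▸ h f⟩
  · exact fun h f => (h _ (HSpace.coeff_spec f).1 (HSpace.coeff_spec f).2.1).2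

/-! ### Bounded Dirichlet series are multipliers -/

/-- The weights `w n` are averages of the weights `n ^ (-2 σ)`, `0 ≤ σ`, in a weak sense. -/
def IsAverage (w : ℕ → ℝ) (n₀ : ℕ) : Prop :=
  ∀ (N : ℕ) (x y : ℕ → ℝ), (∀ n < n₀, x n = 0) → (∀ n < n₀, y n = 0) →
    (∀ σ : ℝ, 0 ≤ σ → ∑ n ∈ Finset.Icc 1 N, x n * (n : ℝ) ^ (-2 * σ) ≤
      ∑ n ∈ Finset.Icc 1 N, y n * (n : ℝ) ^ (-2 * σ)) →
    ∑ n ∈ Finset.Icc 1 N, x n * w n ≤ ∑ n ∈ Finset.Icc 1 N, y n * w n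

/-- The coefficients of b ⍟ a up to N depend only on those of a up to N, so the inequality for each
n^(-2σ) is a finite one and can be averaged before N → ∞. -/
theorem IsAverage.isConvBound {w : ℕ → ℝ} {n₀ : ℕ} (hav : IsAverage w n₀) (hw : SlowDecay w n₀)
    (hn₀ : 1 ≤ n₀) {F : ℂ → ℂ} (hF : DifferentiableOn ℂ F (halfPlane 0)) {K : ℝ}
    (hK : ∀ s ∈ halfPlane 0, ‖F s‖ ≤ K) {b : ℕ → ℂ} {ρ : ℝ}
    (hb : ∀ s ∈ halfPlane 0, ρ < s.re → LSeriesHasSum b s (F s)) : IsConvBound w n₀ b K := by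
  intro a ha0 ha
  have hnn : ∀ a : ℕ → ℂ, (∀ n < n₀, a n = 0) → ∀ n, 0 ≤ ‖a n‖ ^ 2 * w n := by
    intro a ha0 n
    by_cases hn : n < n₀
    · simp [ha0 n hn]
    · have := hw.pos hn₀ (n := n) (by omega)
      positivity
  have hba0 : ∀ n < n₀, (b ⍟ a) n = 0 := fun n hn => convolution_eq_zero_of_lt b ha0 hn
  have hsum : ∀ N, ∑ n ∈ Finset.range N, ‖(b ⍟ a) n‖ ^ 2 * w n ≤
      K ^ 2 * ∑' n, ‖a n‖ ^ 2 * w n := by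
    intro N
    calc ∑ n ∈ Finset.range N, ‖(b ⍟ a) n‖ ^ 2 * w n
        ≤ ∑ n ∈ Finset.Icc 1 N, ‖(b ⍟ a) n‖ ^ 2 * w n := by
          rw [← Finset.sum_filter_ne_zero]
          refine Finset.sum_le_sum_of_subset_of_nonneg (fun n hn => ?_) fun n _ _ => hnn _ hba0 n
          obtain ⟨h1, h2⟩ := Finset.mem_filter.mp hn
          rcases eq_or_ne n 0 with rfl | h0
          · simp at h2
          · exact Finset.mem_Icc.mpr ⟨by omega, (Finset.mem_range.mp h1).le⟩
      _ ≤ ∑ n ∈ Finset.Icc 1 N, K ^ 2 * ‖a n‖ ^ 2 * w n :=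
          hav N (fun n => ‖(b ⍟ a) n‖ ^ 2) (fun n => K ^ 2 * ‖a n‖ ^ 2)
            (fun n hn => by simp [hba0 n hn]) (fun n hn => by simp [ha0 n hn])
            fun σ hσ => sum_norm_convolution_sq_rpow_le hF hK hb N a hσ
      _ = K ^ 2 * ∑ n ∈ Finset.Icc 1 N, ‖a n‖ ^ 2 * w n := by
          rw [Finset.mul_sum]
          exact Finset.sum_congr rfl fun n _ => mul_assoc _ _ _
      _ ≤ _ := mul_le_mul_of_nonneg_left (ha.sum_le_tsum _ fun n _ => hnn a ha0 n) (sq_nonneg K)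
  exact ⟨summable_of_sum_range_le (hnn _ hba0) hsum,
    Real.tsum_le_of_sum_range_le (hnn _ hba0) hsum⟩

/-! ### Restriction, extension and the isometry. -/

theorem eqOn_halfPlane {F G : ℂ → ℂ} {ρ τ : ℝ} (hF : DifferentiableOn ℂ F (halfPlane ρ))
    (hG : DifferentiableOn ℂ G (halfPlane ρ)) (h : ∀ s ∈ halfPlane ρ, τ < s.re → F s = G s) :
    Set.EqOn F G (halfPlane ρ) := by
  have hopen : ∀ x : ℝ, IsOpen (halfPlane x) := fun x =>
    isOpen_lt continuous_const Complex.continuous_re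
  have hmem : (((max ρ τ + 1 : ℝ) : ℂ)) ∈ halfPlane ρ := by
    change ρ < _
    rw [Complex.ofReal_re]
    linarith [le_max_left ρ τ]
  have hmem' : (((max ρ τ + 1 : ℝ) : ℂ)) ∈ halfPlane τ := by
    change τ < _
    rw [Complex.ofReal_re]
    linarith [le_max_right ρ τ]
  refine AnalyticOnNhd.eqOn_of_preconnected_of_eventuallyEq (hF.analyticOnNhd (hopen ρ))
    (hG.analyticOnNhd (hopen ρ)) (convex_halfSpace_re_gt ρ).isPreconnected hmem ?_
  filter_upwards [(hopen ρ).mem_nhds hmem, (hopen τ).mem_nhds hmem'] with s h1 h2 using h s h1 h2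

/-- The Dirichlet series of a function in `H^∞(Ω_0) ∩ D` converges to it on `Ω_{1/2}`. -/
theorem IsConvBound.lseriesHasSum {w : ℕ → ℝ} {n₀ : ℕ} {b : ℕ → ℂ} {K : ℝ}
    (hbK : IsConvBound w n₀ b K) (hw : SlowDecay w n₀) (hn₀ : 1 ≤ n₀) (hb0 : b 0 = 0) {F : ℂ → ℂ}
    (hF : DifferentiableOn ℂ F (halfPlane 0)) {ρ : ℝ}
    (hb : ∀ s ∈ halfPlane 0, ρ < s.re → LSeriesHasSum b s (F s)) {s : ℂ} (hs : 1 / 2 < s.re) :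
    LSeriesHasSum b s (F s) := by
  have hsub : halfPlane (1 / 2) ⊆ halfPlane 0 := fun s hs =>
    lt_trans (by norm_num : (0 : ℝ) < 1 / 2) hs
  -- The first convolution power alone shows that `b` is square summable for the shifted weights,
  -- hence absolutely convergent on Ω_{1/2}.
  have hbs := (hbK.convPow_le hw hn₀ 1).1
  rw [show convPow b 1 = b from convolution_delta hb0] at hbs
  have hsum : ∀ z : ℂ, 1 / 2 < z.re → LSeriesSummable b z := fun z hz =>
    (hw.comp_mul hn₀).lseriesSummable le_rfl (fun n hn => by rw [Nat.lt_one_iff.mp hn, hb0]) hbs hz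
  have heq := eqOn_halfPlane (τ := ρ) (differentiableOn_lseries hsum) (hF.mono hsub)
    (fun z hz hρ => (hb z (hsub hz) hρ).LSeries_eq)
  rw [← heq hs]
  exact (hsum s hs).LSeriesHasSum

/-- The restriction to `Ω_{1/2}` of a function in `H^∞(Ω_0) ∩ D` is a convergent Dirichlet
series whose coefficients define a bounded convolution operator. -/
theorem exists_coeff_of_hInfD {w : ℕ → ℝ} {n₀ : ℕ} (hav : IsAverage w n₀) (hw : SlowDecay w n₀)
    (hn₀ : 1 ≤ n₀) (ψ : hInfD) :
    ∃ b : ℕ → ℂ, (∀ s : halfPlane (1 / 2), LSeriesHasSum b s (ψ.1 (halfPlaneIncl s))) ∧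
      IsConvBound w n₀ b (hInfNorm ψ) := by
  obtain ⟨⟨F, hF, hψF⟩, ⟨C, hC⟩, hD⟩ := ψ.2
  obtain ⟨b', ρ, hb'⟩ := (memD_iff ψ.1).mp hD
  have hcongr : ∀ {n}, n ≠ 0 → Function.update b' 0 0 n = b' n := fun {n} hn =>
    Function.update_of_ne hn _ _
  have hb : ∀ s ∈ halfPlane 0, ρ < s.re → LSeriesHasSum (Function.update b' 0 0) s (F s) := by
    intro s hs hρ
    rw [← hψF ⟨s, hs⟩]
    exact (LSeriesHasSum_congr s _ hcongr).mpr (hb' ⟨s, hs⟩ hρ)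
  have hK : ∀ s ∈ halfPlane 0, ‖F s‖ ≤ hInfNorm ψ := by
    intro s hs
    rw [← hψF ⟨s, hs⟩]
    exact le_ciSup (f := fun s : halfPlane 0 => ‖ψ.1 s‖) ⟨C, by rintro _ ⟨z, rfl⟩; exact hC z⟩
      ⟨s, hs⟩
  have hbK := hav.isConvBound hw hn₀ hF hK hb
  refine ⟨_, fun s => ?_, hbK⟩
  rw [hψF]
  exact hbK.lseriesHasSum hw hn₀ (by simp) hF hb s.2

/-- Restriction to `Ω_{1/2}`, from `H^∞(Ω_0) ∩ D` to the multiplier algebra of `H_w`. -/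
noncomputable def restrictHom {w : ℕ → ℝ} {n₀ : ℕ} (hav : IsAverage w n₀) (hw : SlowDecay w n₀)
    (hn₀ : 1 ≤ n₀) : hInfD →ₐ[ℂ] multiplierAlgebra w n₀ where
  toFun ψ := ⟨ψ.1 ∘ halfPlaneIncl, fun f hf => by
    obtain ⟨b, hb, hbK⟩ := exists_coeff_of_hInfD hav hw hn₀ ψ
    obtain ⟨a, ha0, ha, hf⟩ := hf
    exact ⟨b ⍟ a, fun n hn => convolution_eq_zero_of_lt b ha0 hn, (hbK a ha0 ha).1,
      fun s => (hb s).convolution (hf s)⟩⟩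
  map_one' := rfl
  map_mul' _ _ := rfl
  map_zero' := rfl
  map_add' _ _ := rfl
  commutes' _ := rfl

/-- The identity theorem on the connected set Ω_0; it makes the extension of a multiplier unique. -/
theorem hInfD_ext {ψ χ : hInfD} {τ : ℝ} (h : ∀ s : halfPlane 0, τ < s.1.re → ψ.1 s = χ.1 s) :
    ψ = χ := by
  obtain ⟨⟨F, hF, hψF⟩, -, -⟩ := ψ.2
  obtain ⟨⟨G, hG, hχG⟩, -, -⟩ := χ.2
  refine Subtype.ext (funext fun s => ?_)
  rw [hψF, hχG]
  refine eqOn_halfPlane (τ := τ) hF hG (fun z hz hτ => ?_) s.2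
  rw [← hψF ⟨z, hz⟩, ← hχG ⟨z, hz⟩]
  exact h ⟨z, hz⟩ hτ

theorem restrictHom_injective {w : ℕ → ℝ} {n₀ : ℕ} (hav : IsAverage w n₀) (hw : SlowDecay w n₀)
    (hn₀ : 1 ≤ n₀) : Function.Injective (restrictHom hav hw hn₀) := fun _ _ h =>
  hInfD_ext (τ := 1 / 2) fun s hs => congrFun (congrArg Subtype.val h) ⟨s.1, hs⟩

/-- A bounded multiplier extends to a function in `H^∞(Ω_0) ∩ D` with the same bound. -/
theorem exists_hInfD_of_isConvBound {w : ℕ → ℝ} {n₀ : ℕ} (hw : SlowDecay w n₀)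
    (hn₀ : 1 ≤ n₀) {b : ℕ → ℂ} {C : ℝ} (hC : 0 < C)
    (hb : IsConvBound w n₀ b C) {f : halfPlane (1 / 2) → ℂ}
    (hf : ∀ s : halfPlane (1 / 2), LSeriesHasSum b s (f s)) :
    ∃ ψ : hInfD, (∀ s, ψ.1 (halfPlaneIncl s) = f s) ∧ ∀ s, ‖ψ.1 s‖ ≤ C := by
  obtain ⟨F, hF, hFC, hFb⟩ := hb.exists_extension hw hn₀ hC
  have hmem : (fun s : halfPlane 0 => F s) ∈ hInfD := ⟨⟨F, hF, fun _ => rfl⟩,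
    ⟨C, fun s => hFC s s.2⟩, (memD_iff _).mpr ⟨b, 1, fun s hs => hFb s hs.le⟩⟩
  refine ⟨⟨_, hmem⟩, fun s => ?_, fun s => hFC s s.2⟩
  have hsub : halfPlane (1 / 2) ⊆ halfPlane 0 := fun s hs =>
    lt_trans (by norm_num : (0 : ℝ) < 1 / 2) hs
  have heq := eqOn_halfPlane (τ := 1) (hF.mono hsub)
    (differentiableOn_lseries fun z hz => (hf ⟨z, hz⟩).LSeriesSummable)
    fun z _ h1 => (hFb z h1.le).LSeries_eq.symm
  exact (heq s.2).trans (hf s).LSeries_eq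

/-- The identification of the multiplier algebra for abstract weights. -/
theorem multiplierAlgebraIsHInfD {w : ℕ → ℝ} {n₀ : ℕ} (hav : IsAverage w n₀)
    (hw : SlowDecay w n₀) (hn₀ : 1 ≤ n₀) : MultiplierAlgebraIsHInfD w n₀ := by
  have hbdd : ∀ φ : multiplierAlgebra w n₀, ∃ b : ℕ → ℂ,
      (∀ s : halfPlane (1 / 2), LSeriesHasSum b s (φ.1 s)) ∧ ∃ C, IsMulBound φ C := by
    intro φ
    obtain ⟨b, hb⟩ := exists_lseriesHasSum_of_multiplier hw hn₀ φ
    obtain ⟨C, hC⟩ := exists_isConvBound hw hn₀ (b := b) fun a ha0 ha => by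
      obtain ⟨f, rfl⟩ := hw.exists_coeff_eq hn₀ ha0 ha
      rw [← coeff_mulOp hn₀ hb]
      exact (HSpace.coeff_spec _).2.1
    exact ⟨b, hb, C, (isMulBound_iff hw hn₀ hb).mpr hC⟩
  -- The extension theorem needs a positive bound, while C may be 0; hence the strictly larger C'.
  have hext : ∀ φ : multiplierAlgebra w n₀, ∀ C, IsMulBound φ C → ∀ C', C < C' →
      ∃ ψ : hInfD, restrictHom hav hw hn₀ ψ = φ ∧ ∀ s, ‖ψ.1 s‖ ≤ C' := by
    intro φ C hC C' hCC'
    obtain ⟨b, hb, -⟩ := hbdd φ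
    have hC'0 : 0 < C' := hC.1.trans_lt hCC'
    have hC' : IsMulBound φ C' := ⟨hC'0.le, fun f => (hC.2 f).trans
      (mul_le_mul_of_nonneg_right hCC'.le (Real.sqrt_nonneg _))⟩
    obtain ⟨ψ, h1, h2⟩ := exists_hInfD_of_isConvBound hw hn₀ hC'0
      ((isMulBound_iff hw hn₀ hb).mp hC').2 hb
    exact ⟨ψ, Subtype.ext (funext h1), h2⟩
  have hinj := restrictHom_injective hav hw hn₀
  have hbij : Function.Bijective (restrictHom hav hw hn₀) := by
    refine ⟨hinj, fun φ => ?_⟩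
    obtain ⟨b, -, C, hC⟩ := hbdd φ
    obtain ⟨ψ, h, -⟩ := hext φ C hC (C + 1) (lt_add_one C)
    exact ⟨ψ, h⟩
  set E := AlgEquiv.ofBijective (restrictHom hav hw hn₀) hbij with hE
  have hEs : ∀ φ, restrictHom hav hw hn₀ (E.symm φ) = φ := E.apply_symm_apply
  refine ⟨fun φ => (hbdd φ).choose_spec.2, E.symm, fun φ s => ?_, fun φ => ?_⟩
  · exact congrFun (congrArg Subtype.val (hEs φ)) s
  -- The admissible bounds form a closed ray starting at the supremum norm, so their infimum is that
  -- norm. Uniqueness of the extension lets one function serve for every C + ε.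
  · have hset : {C | IsMulBound φ C} = Set.Ici (hInfNorm (E.symm φ)) := by
      have hn0 : 0 ≤ hInfNorm (E.symm φ) := Real.iSup_nonneg fun _ => norm_nonneg _
      ext C
      refine ⟨fun hC => ?_, fun hC => ?_⟩
      · have : Nonempty (halfPlane 0) := ⟨⟨1, by simp [halfPlane]⟩⟩
        change (⨆ s : halfPlane 0, ‖(E.symm φ).1 s‖) ≤ C
        refine ciSup_le fun s => ?_
        refine le_of_forall_pos_le_add fun ε hε => ?_
        obtain ⟨ψ, h1, h2⟩ := hext φ C hC (C + ε) (lt_add_of_pos_right C hε)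
        rw [← hinj (h1.trans (hEs φ).symm)]
        exact h2 s
      · obtain ⟨b, hb, hbK⟩ := exists_coeff_of_hInfD hav hw hn₀ (E.symm φ)
        have hb' : ∀ s : halfPlane (1 / 2), LSeriesHasSum b s (φ.1 s) := fun s => by
          rw [← hEs φ]
          exact hb s
        obtain ⟨-, h⟩ := (isMulBound_iff hw hn₀ hb').mpr ⟨hn0, hbK⟩
        exact ⟨hn0.trans hC, fun f => (h f).trans
          (mul_le_mul_of_nonneg_right hC (Real.sqrt_nonneg _))⟩
    rw [multiplierNorm, hset, csInf_Ici]

/-! ### Weights -/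

/-- Integrating the pointwise inequality against a nonnegative density preserves it. The density `g`
and exponent `τ` are general so as to cover both moment weights and logarithmic weights. -/
theorem isAverage_of_integral {X : Type*} [MeasurableSpace X] {μ : Measure X} {g τ : X → ℝ}
    (hg : ∀ᵐ x ∂μ, 0 ≤ g x) (hτ : ∀ᵐ x ∂μ, 0 ≤ τ x) {w : ℕ → ℝ} {n₀ : ℕ}
    (hint : ∀ n, n₀ ≤ n → Integrable (fun x => g x * (n : ℝ) ^ (-2 * τ x)) μ)
    (hw : ∀ n, n₀ ≤ n → w n = ∫ x, g x * (n : ℝ) ^ (-2 * τ x) ∂μ) : IsAverage w n₀ := by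
  have hxint : ∀ x : ℕ → ℝ, (∀ n < n₀, x n = 0) → ∀ n,
      Integrable (fun t => x n * (g t * (n : ℝ) ^ (-2 * τ t))) μ := by
    intro x hx n
    by_cases hn : n < n₀
    · simp [hx n hn]
    · exact (hint n (by omega)).const_mul _
  have hxsum : ∀ (N : ℕ) (x : ℕ → ℝ), (∀ n < n₀, x n = 0) → ∑ n ∈ Finset.Icc 1 N, x n * w n =
      ∫ t, ∑ n ∈ Finset.Icc 1 N, x n * (g t * (n : ℝ) ^ (-2 * τ t)) ∂μ := by
    intro N x hx
    rw [integral_finsetSum _ fun n _ => hxint x hx n]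
    refine Finset.sum_congr rfl fun n _ => ?_
    by_cases hn : n < n₀
    · simp [hx n hn]
    · rw [integral_const_mul, hw n (by omega)]
  intro N x y hx hy h
  rw [hxsum N x hx, hxsum N y hy]
  refine integral_mono_ae (integrable_finsetSum _ fun n _ => hxint x hx n)
    (integrable_finsetSum _ fun n _ => hxint y hy n) ?_
  filter_upwards [hg, hτ] with t ht1 ht2
  have h1 := mul_le_mul_of_nonneg_left (h (τ t) ht2) ht1
  simpa only [Finset.mul_sum, mul_left_comm] using h1

theorem integrable_moment {μ : Measure ℝ≥0} {n₀ : ℕ} (hn₀ : 1 ≤ n₀)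
    (hμ : Integrable (fun σ : ℝ≥0 => (n₀ : ℝ) ^ (-2 * (σ : ℝ))) μ) {n : ℕ} (hn : n₀ ≤ n) :
    Integrable (fun σ : ℝ≥0 => (n : ℝ) ^ (-2 * (σ : ℝ))) μ := by
  have h0 : (0 : ℝ) < n₀ := by exact_mod_cast hn₀
  have h1 : (0 : ℝ) < n := by exact_mod_cast hn₀.trans hn
  have hc : Continuous fun σ : ℝ≥0 => (n : ℝ) ^ (-2 * (σ : ℝ)) :=
    (Real.continuous_const_rpow h1.ne').comp (by fun_prop)
  refine hμ.mono' hc.aestronglyMeasurable (Eventually.of_forall fun σ => ?_)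
  rw [Real.norm_of_nonneg (by positivity)]
  refine Real.rpow_le_rpow_of_nonpos h0 (by exact_mod_cast hn) ?_
  have := σ.2
  change 0 ≤ (σ : ℝ) at this
  linarith

theorem isAverage_momentWeight {μ : Measure ℝ≥0} {n₀ : ℕ} (hn₀ : 1 ≤ n₀)
    (hμ : Integrable (fun σ : ℝ≥0 => (n₀ : ℝ) ^ (-2 * (σ : ℝ))) μ) :
    IsAverage (momentWeight μ) n₀ :=
  isAverage_of_integral (g := fun _ => 1) (τ := fun σ : ℝ≥0 => (σ : ℝ))
    (Eventually.of_forall fun _ => zero_le_one) (Eventually.of_forall fun σ => σ.2)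
    (fun n hn => by simpa only [one_mul] using integrable_moment hn₀ hμ hn)
    (fun n _ => by simp only [one_mul, momentWeight])

/-- Since 0 is in the support, [0, ε/2] has positive mass, and n^(-2σ) ≥ n^(-ε) there. -/
theorem slowDecay_momentWeight {μ : Measure ℝ≥0} [IsFiniteMeasureOnCompacts μ] {n₀ : ℕ}
    (hn₀ : 1 ≤ n₀) (hμ : Integrable (fun σ : ℝ≥0 => (n₀ : ℝ) ^ (-2 * (σ : ℝ))) μ)
    (h0 : (0 : ℝ≥0) ∈ μ.support) : SlowDecay (momentWeight μ) n₀ := by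
  intro ε hε
  set r : ℝ≥0 := ⟨ε / 2, by positivity⟩ with hr
  have hr0 : 0 < r := NNReal.coe_pos.mp (by rw [hr]; change 0 < ε / 2; positivity)
  have hpos : 0 < μ (Set.Icc 0 r) := (Measure.mem_support_iff_forall 0).mp h0 _
    (mem_of_superset (Iio_mem_nhds hr0) fun x hx => ⟨zero_le, le_of_lt hx⟩)
  have hfin : μ (Set.Icc 0 r) ≠ ⊤ := isCompact_Icc.measure_lt_top.ne
  refine ⟨μ.real (Set.Icc 0 r), ENNReal.toReal_pos hpos.ne' hfin, fun n hn => ?_⟩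
  have h1 : (1 : ℝ) ≤ n := by exact_mod_cast hn₀.trans hn
  have hint := integrable_moment hn₀ hμ hn
  calc μ.real (Set.Icc 0 r) * (n : ℝ) ^ (-ε)
      = ∫ _ in Set.Icc 0 r, (n : ℝ) ^ (-ε) ∂μ := by rw [setIntegral_const, smul_eq_mul]
    _ ≤ ∫ σ in Set.Icc 0 r, (n : ℝ) ^ (-2 * (σ : ℝ)) ∂μ := by
        refine setIntegral_mono_on (integrableOn_const hfin) hint.integrableOn measurableSet_Icc
          fun σ hσ => Real.rpow_le_rpow_of_exponent_le h1 ?_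
        have h2 : (σ : ℝ) ≤ ε / 2 := NNReal.coe_le_coe.mpr hσ.2
        linarith
    _ ≤ _ := setIntegral_le_integral hint (Eventually.of_forall fun σ => by
        change (0 : ℝ) ≤ _
        positivity)

theorem isAverage_one (n₀ : ℕ) : IsAverage (fun _ => 1) n₀ := by
  intro N x y _ _ h
  simpa using h 0 le_rfl

theorem slowDecay_one {n₀ : ℕ} (hn₀ : 1 ≤ n₀) : SlowDecay (fun _ => 1) n₀ := by
  refine fun ε hε => ⟨1, one_pos, fun n hn => ?_⟩
  rw [one_mul]
  exact Real.rpow_le_one_of_one_le_of_nonpos (by exact_mod_cast hn₀.trans hn)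
    (by linarith)

/-- The Gamma integral writes (log n)^α as Γ(-α)⁻¹ ∫ t^(-α-1) n^(-t) dt over t > 0, with t = 2σ; it
needs log n > 0, hence n ≥ 2. -/
theorem isAverage_log {α : ℝ} (hα : α < 0) : IsAverage (fun n => Real.log n ^ α) 2 := by
  have hβ : 0 < -α := by linarith
  have hΓ : 0 < Real.Gamma (-α) := Real.Gamma_pos_of_pos hβ
  have hlog : ∀ n : ℕ, 2 ≤ n → 0 < Real.log n := fun n hn =>
    Real.log_pos (by exact_mod_cast hn)
  have heq : ∀ n : ℕ, 2 ≤ n → Real.log n ^ α = ∫ t in Set.Ioi (0 : ℝ),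
      (Real.Gamma (-α))⁻¹ * t ^ (-α - 1) * (n : ℝ) ^ (-2 * (t / 2)) := by
    intro n hn
    have h1 := Real.integral_rpow_mul_exp_neg_mul_Ioi hβ (hlog n hn)
    have h2 : (0 : ℝ) < n := by positivity
    calc Real.log n ^ α = (Real.Gamma (-α))⁻¹ * ((1 / Real.log n) ^ (-α) * Real.Gamma (-α)) := by
          rw [one_div, Real.inv_rpow (hlog n hn).le, ← Real.rpow_neg (hlog n hn).le, neg_neg]
          field_simp
      _ = _ := by
          rw [← h1, ← integral_const_mul]
          refine integral_congr_ae (Eventually.of_forall fun t => ?_)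
          simp only
          rw [Real.rpow_def_of_pos h2, mul_assoc]
          ring_nf
  refine isAverage_of_integral (μ := volume.restrict (Set.Ioi (0 : ℝ)))
    (g := fun t => (Real.Gamma (-α))⁻¹ * t ^ (-α - 1)) (τ := fun t => t / 2) ?_ ?_
    (fun n hn => ?_) heq
  · filter_upwards [ae_restrict_mem measurableSet_Ioi] with t ht
    have : (0 : ℝ) < t := ht
    positivity
  · filter_upwards [ae_restrict_mem measurableSet_Ioi] with t ht
    have : (0 : ℝ) < t := ht
    positivity
  -- A non-integrable function has Bochner integral 0, whereas this integral is the positive number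
  -- (log n)^α.
  · refine Integrable.of_integral_ne_zero ?_
    rw [← heq n hn]
    exact (Real.rpow_pos_of_pos (hlog n hn) α).ne'

/-- Raise log n ≤ n^d / d to the negative power α; d = ε/(-α) makes the exponent of n equal to -ε.
-/
theorem slowDecay_log {α : ℝ} (hα : α < 0) : SlowDecay (fun n => Real.log n ^ α) 2 := by
  intro ε hε
  set d : ℝ := ε / -α with hd
  have hd0 : 0 < d := div_pos hε (by linarith)
  refine ⟨d ^ (-α), by positivity, fun n hn => ?_⟩
  have hn0 : (0 : ℝ) < n := by positivity
  have hlog : 0 < Real.log n := Real.log_pos (by exact_mod_cast hn)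
  refine le_trans (le_of_eq ?_)
    (Real.rpow_le_rpow_of_nonpos hlog (Real.log_le_rpow_div hn0.le hd0) hα.le)
  rw [Real.div_rpow (by positivity) hd0.le, ← Real.rpow_mul hn0.le, Real.rpow_neg hd0.le,
    div_eq_mul_inv, mul_comm]
  congr 2
  rw [hd]
  have : α ≠ 0 := hα.ne
  field_simp

end DirichletHilbert

theorem mainTheorem1 :
    -- the theorem for a general measure
    (∀ (μ : MeasureTheory.Measure NNReal) [μ.Regular] (n₀ : ℕ), 1 ≤ n₀ →
      MeasureTheory.Integrable (fun σ : NNReal => (n₀ : ℝ) ^ (-2 * (σ : ℝ))) μ →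
      (0 : NNReal) ∈ μ.support →
      DirichletHilbert.MultiplierAlgebraIsHInfD (DirichletHilbert.momentWeight μ) n₀) ∧
    -- the special case of constant weights
    DirichletHilbert.MultiplierAlgebraIsHInfD (fun _ => 1) 1 ∧
    -- the special case of logarithmic weights
    (∀ α : ℝ, α ≤ 0 →
      DirichletHilbert.MultiplierAlgebraIsHInfD (fun n => Real.log n ^ α) 2) := by
  refine ⟨fun μ _ n₀ hn₀ hμ h0 => ?_, ?_, fun α hα => ?_⟩
  · exact DirichletHilbert.multiplierAlgebraIsHInfD
      (DirichletHilbert.isAverage_momentWeight hn₀ hμ)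
      (DirichletHilbert.slowDecay_momentWeight hn₀ hμ h0) hn₀
  · exact DirichletHilbert.multiplierAlgebraIsHInfD (DirichletHilbert.isAverage_one 1)
      (DirichletHilbert.slowDecay_one le_rfl) le_rfl
  -- The Gamma integral diverges at α = 0, where the weights are constant.
  · rcases hα.lt_or_eq with hα | rfl
    · exact DirichletHilbert.multiplierAlgebraIsHInfD (DirichletHilbert.isAverage_log hα)
        (DirichletHilbert.slowDecay_log hα) one_le_two
    · simp only [Real.rpow_zero]
      exact DirichletHilbert.multiplierAlgebraIsHInfD (DirichletHilbert.isAverage_one 2)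
        (DirichletHilbert.slowDecay_one one_le_two) one_le_two
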